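/- Let $p>1$, $f,g,\rho\in C[0,1]$ and $d\in C^1(0,1)$ satisfy: $\rho>0$ in $(0,1)$ and $\rho(0)=\rho(1)=0$; $g(0)>0$ and $\int_0^u g(s)\,ds>0$ for every $u\in(0,1]$; $d>0$ in $(0,1)$ and $\rho\, d^{\frac1{p-1}}\in L^1(0,1)$. A traveling wave solution of speed $c\in\mathbb R$ of the equation $$f(u)u_x+g(u)u_\tau=[d(u)|u_x|^{p-2}u_x]_x+\rho(u)$$ is a function $u\in C^1(\alpha,\beta)$, $-\infty\le\alpha<\beta\le+\infty$, with $0<u<1$ in $(\alpha,\beta)$, $d(u)|u'|^{p-2}u'\in C^1(\alpha,\beta)$, $$\bigl(d(u)|u'|^{p-2}u'\bigr)'+(c\,g(u)-f(u))u'+\rho(u)=0\quad\text{in }(\alpha,\beta),$$ $u(t)\to1$ as $t\to\alpha^+$, $u(t)\to0$ as $t\to\beta^-$, and $d(u(t))|u'(t)|^{p-2}u'(t)\to0$ both as $t\to\alpha^+$ and as $t\to\beta^-$. Let $c^*$ be the critical speed, i.e. the infimum of the speeds $c$ for which a traveling wave solution exists. Theorem. Assume that the limit $\ell_0:=\lim_{u\to0^+}\rho(u)\bigl(d(u)/u\bigr)^{\frac1{p-1}}$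 exists and is finite, and let $u$ be a traveling wave solution of speed $c=c^*$, defined in $(\alpha,\beta)$. Then: (a) if $\ell_0>0$, then $\beta<+\infty$ if and only if $\int_0^{1/2}\frac{1}{\rho(u)}\,du<+\infty$; (b) if $\ell_0=0$ and $c^*g(0)>f(0)$, then $\beta<+\infty$ if and only if $\int_0^{1/2}\bigl(\frac{d(u)}{u}\bigr)^{\frac1{p-1}}du<+\infty$; (c) if $\ell_0=c^*g(0)-f(0)=0$ and there exist constants $\delta\in(0,1)$, $\mu,M>0$ and a function $\xi\in C^1[0,\delta]$ such that $\mu\,\xi(u)\le d(u)(\rho(u))^{p-1}\le M\,\xi(u)$ for every $u\in(0,\delta)$, then $\int_0^{1/2}\frac{1}{\rho(u)}\,du<+\infty$ implies $\beta<+\infty$. -/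

import Mathlib

open Set Filter Topology MeasureTheory

namespace ReactionDiffusion

/-- The standing assumptions on the exponent and the coefficients of
`f(u) u_x + g(u) u_τ = [d(u) |u_x|^(p-2) u_x]_x + ρ(u)`:
`p > 1`, `f, g, ρ ∈ C[0,1]`, `d ∈ C¹(0,1)`, `ρ > 0` in `(0,1)` with `ρ(0) = ρ(1) = 0`,
`g(0) > 0` and `∫₀ᵘ g > 0` for `u ∈ (0,1]`, `d > 0` in `(0,1)` and
`ρ d^(1/(p-1)) ∈ L¹(0,1)`. -/
structure IsMonostable (p : ℝ) (f g d ρ : ℝ → ℝ) : Prop where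
  one_lt_p : 1 < p
  continuousOn_f : ContinuousOn f (Icc 0 1)
  continuousOn_g : ContinuousOn g (Icc 0 1)
  continuousOn_reaction : ContinuousOn ρ (Icc 0 1)
  contDiffOn_d : ContDiffOn ℝ 1 d (Ioo 0 1)
  reaction_pos : ∀ u ∈ Ioo (0 : ℝ) 1, 0 < ρ u
  reaction_zero : ρ 0 = 0
  reaction_one : ρ 1 = 0
  g_zero_pos : 0 < g 0
  integral_g_pos : ∀ u ∈ Ioc (0 : ℝ) 1, 0 < ∫ s in (0 : ℝ)..u, g s
  d_pos : ∀ u ∈ Ioo (0 : ℝ) 1, 0 < d u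
  integrableOn_reaction_mul_d : IntegrableOn (fun u => ρ u * d u ^ (1 / (p - 1))) (Ioo 0 1)

/-- The real open interval `(α, β)` with extended real endpoints. -/
def openInterval (α β : EReal) : Set ℝ :=
  {t : ℝ | α < (t : EReal) ∧ (t : EReal) < β}

/-- The filter of real `t → α⁺` (it is `atBot` if `α = -∞`). -/
noncomputable def rightOf (α : EReal) : Filter ℝ :=
  comap (fun t : ℝ => (t : EReal)) (𝓝[>] α)

/-- The filter of real `t → β⁻` (it is `atTop` if `β = +∞`). -/
noncomputable def leftOf (β : EReal) : Filter ℝ :=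
  comap (fun t : ℝ => (t : EReal)) (𝓝[<] β)

/-- The flux `t ↦ d(u(t)) |u'(t)|^(p-2) u'(t)`. Where `u'(t) = 0` its value is `0`,
for every `p > 1`. -/
noncomputable def flux (p : ℝ) (d u : ℝ → ℝ) (t : ℝ) : ℝ :=
  d (u t) * |deriv u t| ^ (p - 2) * deriv u t

/-- `u` is, on its existence interval `(α, β) ⊆ ℝ`, a traveling wave solution of speed `c`
connecting `1` (at `α`) to `0` (at `β`). -/
structure IsTravelingWave (p : ℝ) (f g d ρ : ℝ → ℝ) (c : ℝ) (α β : EReal) (u : ℝ → ℝ) :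
    Prop where
  lt : α < β
  contDiffOn : ContDiffOn ℝ 1 u (openInterval α β)
  mem_Ioo : ∀ t ∈ openInterval α β, u t ∈ Ioo (0 : ℝ) 1
  contDiffOn_flux : ContDiffOn ℝ 1 (flux p d u) (openInterval α β)
  equation : ∀ t ∈ openInterval α β,
    deriv (flux p d u) t + (c * g (u t) - f (u t)) * deriv u t + ρ (u t) = 0
  tendsto_left : Tendsto u (rightOf α) (𝓝 1)
  tendsto_right : Tendsto u (leftOf β) (𝓝 0)
  flux_tendsto_left : Tendsto (flux p d u) (rightOf α) (𝓝 0)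
  flux_tendsto_right : Tendsto (flux p d u) (leftOf β) (𝓝 0)

/-- The set of speeds `c` for which a traveling wave solution exists. -/
def admissibleSpeeds (p : ℝ) (f g d ρ : ℝ → ℝ) : Set ℝ :=
  {c : ℝ | ∃ (α β : EReal) (u : ℝ → ℝ), IsTravelingWave p f g d ρ c α β u}

/-- The critical (threshold, minimal) wave speed `c*`. -/
noncomputable def criticalSpeed (p : ℝ) (f g d ρ : ℝ → ℝ) : ℝ :=
  sInf (admissibleSpeeds p f g d ρ)

/-- The comparability condition: near `0⁺` the function `d ρ^(p-1)` lies between two positive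
multiples of a function `ξ` that is `C¹` up to `0`. -/
def ComparableToC1 (p : ℝ) (d ρ : ℝ → ℝ) : Prop :=
  ∃ (δ μ M : ℝ) (ξ : ℝ → ℝ), 0 < δ ∧ δ < 1 ∧ 0 < μ ∧ 0 < M ∧
    ContDiffOn ℝ 1 ξ (Icc 0 δ) ∧
    ∀ u ∈ Ioo (0 : ℝ) δ, μ * ξ u ≤ d u * ρ u ^ (p - 1) ∧ d u * ρ u ^ (p - 1) ≤ M * ξ u

end ReactionDiffusion

/-! A traveling wave is strictly decreasing, so its flux can be read as a function of the state: `z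
s` is minus the flux at the time when `u = s`. With `q = 1 / (p - 1)`, the wave equation becomes the
singular first order equation `z' = h - k / z ^ q` on `(0, 1)`, where `h = c g - f` and `k = ρ d ^
q`, and `z` vanishes at both ends. Conversely, every such profile comes from a wave. Time is
recovered from `dt/ds = -(d / z) ^ q`, so `β` is finite exactly when `(d / z) ^ q` is integrable at
`0`, and everything depends on how fast `z` decays there.

Dropping the singular term gives `z ≤ K s` for every speed. The lower bounds differ. In (a), `k / (κ
s) ^ q` is large for small `κ`, so the line `κ s` is a barrier below `z`
(`IsProfile.exists_barrier_le`); thus `z` is comparable to `s`, and `(d / z) ^ q` to `1 / ρ`. In (c)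
the same barrier lemma applies to `κ ξ` and bounds `(d / z) ^ q` by a multiple of `1 / ρ`. In (b)
the singular term is negligible along lines and minimality of the speed takes over
(`IsProfile.exists_mul_le_of_forall_admissible`): if `z` dipped below `κ s` with `κ = h(0) / 2`,
gluing this line to a perturbation of `z` would give a subsolution for a smaller speed, hence a
slower wave.

That subsolutions yield profiles (`exists_isProfile`) rests on one fact: `h - k / z ^ q` is
nondecreasing in `z`, so the flow run backward from the right endpoint is order preserving and
contracting. -/

namespace ReactionDiffusion

/-! ### Backward comparison for the singular equation -/

/-- A continuous function whose right derivative is nonnegative wherever the function is positive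
stays above its initial value, if the latter is positive. -/
theorem le_of_hasDerivWithinAt_nonneg_of_pos {φ φ' : ℝ → ℝ} {a b : ℝ} (hab : a ≤ b)
    (hφ : ContinuousOn φ (Icc a b))
    (hφ' : ∀ x ∈ Ico a b, HasDerivWithinAt φ (φ' x) (Ici x) x)
    (hnonneg : ∀ x ∈ Ico a b, 0 < φ x → 0 ≤ φ' x) (ha : 0 < φ a) : φ a ≤ φ b := by
  -- The line `φ a - e (x - a)` stays positive on `[a, b]`, so `φ` can meet it only where `φ > 0`;
  -- there `φ' ≥ 0 > -e`, which rules out a downward crossing. Then `e` tends to `0`.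
  have key : ∀ e : ℝ, 0 < e → e * (b - a) < φ a → φ a - e * (b - a) ≤ φ b := by
    intro e he hea
    have h := image_le_of_deriv_right_lt_deriv_boundary (f := fun x => -φ x)
      (f' := fun x => -φ' x) (a := a) (b := b) hφ.neg (fun x hx => (hφ' x hx).neg)
      (B := fun x => -φ a + e * (x - a)) (B' := fun _ => e) (by simp)
      (fun x => by
        have := (((hasDerivAt_id x).sub_const a).const_mul e).const_add (-φ a)
        simpa using this)
      (fun x hx hxe => by
        have h1 : e * (x - a) ≤ e * (b - a) := by
          have := hx.2
          gcongr
        have h2 : 0 < φ x := by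
          have : -φ x = -φ a + e * (x - a) := hxe
          linarith
        have := hnonneg x hx h2
        change -φ' x < e
        linarith) (right_mem_Icc.2 hab)
    linarith
  rcases hab.eq_or_lt with rfl | hab
  · exact le_rfl
  refine le_of_forall_pos_le_add fun η hη => ?_
  have hba : 0 < b - a := sub_pos.2 hab
  have hm : 0 < min η (φ a / 2) := lt_min hη (by linarith)
  have h := key (min η (φ a / 2) / (b - a)) (div_pos hm hba)
  rw [div_mul_cancel₀ _ hba.ne'] at h
  have h1 := min_le_left η (φ a / 2)
  have h2 := min_le_right η (φ a / 2)
  have h3 := h (by linarith)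
  linarith

/-- The derivative of `x ^ (-q)` on `[m, ∞)` is largest in size at `m`. This supplies the Lipschitz
constant of the truncated vector field. -/
theorem exists_lipschitz_one_div_rpow {q m : ℝ} (hq : 0 < q) (hm : 0 < m) :
    ∃ L : ℝ, 0 ≤ L ∧ ∀ x y : ℝ, m ≤ x → m ≤ y → |1 / x ^ q - 1 / y ^ q| ≤ L * |x - y| := by
  have hL : (0 : ℝ) ≤ q * m ^ (-q - 1) := by positivity
  refine ⟨q * m ^ (-q - 1), hL, fun x y hx hy => ?_⟩
  have h := Convex.norm_image_sub_le_of_norm_hasDerivWithin_le (f := fun x : ℝ => x ^ (-q))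
    (f' := fun x => -q * x ^ (-q - 1)) (C := q * m ^ (-q - 1)) (s := Ici m)
    (fun x hx => (Real.hasDerivAt_rpow_const (Or.inl (hm.trans_le hx).ne')).hasDerivWithinAt)
    (fun x hx => by
      have hx0 : 0 < x := hm.trans_le hx
      rw [norm_mul, Real.norm_eq_abs, Real.norm_eq_abs, abs_neg, abs_of_pos hq,
        abs_of_pos (by positivity)]
      exact mul_le_mul_of_nonneg_left
        (Real.rpow_le_rpow_of_nonpos hm hx (by linarith)) hq.le)
    (convex_Ici m) hy hx
  simp only [Real.norm_eq_abs] at h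
  rwa [Real.rpow_neg (hm.le.trans hx), Real.rpow_neg (hm.le.trans hy), ← one_div, ← one_div] at h

/-- `z` solves `z' = h - k / z ^ q` on `[a, b]` and is positive there. -/
def SolvesOn (q : ℝ) (h k z : ℝ → ℝ) (a b : ℝ) : Prop :=
  ∀ s ∈ Icc a b, 0 < z s ∧ HasDerivWithinAt z (h s - k s / z s ^ q) (Icc a b) s

namespace SolvesOn

variable {q a b : ℝ} {h k z z₁ z₂ : ℝ → ℝ}

theorem continuousOn (hz : SolvesOn q h k z a b) : ContinuousOn z (Icc a b) :=
  fun s hs => (hz s hs).2.continuousWithinAt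

theorem hasDerivWithinAt_Ici (hz : SolvesOn q h k z a b) {s : ℝ} (hs : s ∈ Ico a b) :
    HasDerivWithinAt z (h s - k s / z s ^ q) (Ici s) s :=
  (hz s (Ico_subset_Icc_self hs)).2.mono_of_mem_nhdsWithin
    (mem_of_superset (Icc_mem_nhdsGE hs.2) (Icc_subset_Icc_left hs.1))

theorem hasDerivAt (hz : SolvesOn q h k z a b) {s : ℝ} (hs : s ∈ Ioo a b) :
    HasDerivAt z (h s - k s / z s ^ q) s :=
  (hz s (Ioo_subset_Icc_self hs)).2.hasDerivAt (Icc_mem_nhds hs.1 hs.2)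

theorem mono {a' b' : ℝ} (hz : SolvesOn q h k z a b) (ha : a ≤ a') (hb : b' ≤ b) :
    SolvesOn q h k z a' b' := fun s hs =>
  ⟨(hz s ⟨ha.trans hs.1, hs.2.trans hb⟩).1,
    (hz s ⟨ha.trans hs.1, hs.2.trans hb⟩).2.mono (Icc_subset_Icc ha hb)⟩

end SolvesOn

/-- Replacing `y` by `max y m` makes the field bounded and globally Lipschitz, so Picard–Lindelöf
covers the whole interval. Below a small level `m` the field points down, so a solution followed
backward never falls below `m` and the truncation is inactive. -/
theorem exists_solvesOn {q a b ε : ℝ} {h k : ℝ → ℝ} (hq : 0 < q) (hab : a ≤ b)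
    (hh : ContinuousOn h (Icc a b)) (hk : ContinuousOn k (Icc a b))
    (hkpos : ∀ s ∈ Icc a b, 0 < k s) (hε : 0 < ε) :
    ∃ z, z b = ε ∧ SolvesOn q h k z a b := by
  have hne : (Icc a b).Nonempty := nonempty_Icc.2 hab
  obtain ⟨H, hH⟩ := isCompact_Icc.exists_bound_of_continuousOn hh
  obtain ⟨K, hK⟩ := isCompact_Icc.exists_bound_of_continuousOn hk
  obtain ⟨x₀, hx₀, hmin⟩ := isCompact_Icc.exists_isMinOn hne hk
  have hk₀ := hkpos x₀ hx₀
  have hH0 : 0 ≤ H := (norm_nonneg _).trans (hH x₀ hx₀)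
  have hK0 : 0 ≤ K := (norm_nonneg _).trans (hK x₀ hx₀)
  -- This level gives `h - k / m ^ q ≤ -1` on `[a, b]` and lies below the terminal value `ε`.
  set m := min ε ((k x₀ / (H + 1)) ^ (1 / q)) with hm_def
  have hm : 0 < m := lt_min hε (by positivity)
  have hmq : m ^ q ≤ k x₀ / (H + 1) := by
    calc m ^ q ≤ ((k x₀ / (H + 1)) ^ (1 / q)) ^ q :=
          Real.rpow_le_rpow hm.le (min_le_right _ _) hq.le
      _ = k x₀ / (H + 1) := by
          rw [← Real.rpow_mul (by positivity), one_div_mul_cancel hq.ne', Real.rpow_one]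
  obtain ⟨L, hL0, hL⟩ := exists_lipschitz_one_div_rpow hq hm
  have hmq0 : 0 < m ^ q := Real.rpow_pos_of_pos hm q
  set F : ℝ → ℝ → ℝ := fun s y => h s - k s / (max y m) ^ q with hF
  have hbound : ∀ s ∈ Icc a b, ∀ y, ‖F s y‖ ≤ H + K / m ^ q := by
    intro s hs y
    refine (norm_sub_le _ _).trans (add_le_add (hH s hs) ?_)
    rw [norm_div, Real.norm_of_nonneg (Real.rpow_nonneg (hm.le.trans (le_max_right y m)) q)]
    exact div_le_div₀ hK0 (hK s hs) hmq0 (Real.rpow_le_rpow hm.le (le_max_right _ _) hq.le)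
  have hB0 : 0 ≤ H + K / m ^ q := by positivity
  -- The bounds hold for all `y`, so the radius may be taken as large as the bound times the length
  -- of the interval.
  have hpl : IsPicardLindelof F (⟨b, right_mem_Icc.2 hab⟩ : Icc a b) ε
      (NNReal.mk ((H + K / m ^ q) * (b - a)) (mul_nonneg hB0 (sub_nonneg.2 hab))) 0
      (NNReal.mk _ hB0) (NNReal.mk _ (mul_nonneg hK0 hL0)) := by
    refine ⟨fun t ht => LipschitzWith.lipschitzOnWith ?_, fun x _ => ?_,
      fun t ht x _ => hbound t ht x, ?_⟩
    · refine LipschitzWith.of_dist_le_mul fun x y => ?_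
      rw [Real.dist_eq, Real.dist_eq, NNReal.coe_mk]
      have e : F t x - F t y = -(k t * (1 / (max x m) ^ q - 1 / (max y m) ^ q)) := by
        simp only [hF]; ring
      rw [e, abs_neg, abs_mul, mul_assoc]
      refine mul_le_mul (hK t ht) ((hL _ _ (le_max_right _ _) (le_max_right _ _)).trans ?_)
        (abs_nonneg _) hK0
      exact mul_le_mul_of_nonneg_left (abs_max_sub_max_le_abs _ _ _) hL0
    · exact hh.sub (hk.div_const _)
    · simp [sub_nonneg.2 hab]
  obtain ⟨z, hzb, hz⟩ := hpl.exists_eq_forall_mem_Icc_hasDerivWithinAt₀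
  have hcont : ContinuousOn z (Icc a b) := fun s hs => (hz s hs).continuousWithinAt
  have hzm : ∀ s ∈ Icc a b, m ≤ z s := by
    intro s hs
    by_contra! hlt
    have hle := le_of_hasDerivWithinAt_nonneg_of_pos (φ := fun x => m - z x)
      (φ' := fun x => -F x (z x)) hs.2
      (continuousOn_const.sub (hcont.mono (Icc_subset_Icc_left hs.1)))
      (fun x hx => by
        have hx' : x ∈ Ico a b := ⟨hs.1.trans hx.1, hx.2⟩
        exact ((hz x (Ico_subset_Icc_self hx')).mono_of_mem_nhdsWithin
          (mem_of_superset (Icc_mem_nhdsGE hx'.2) (Icc_subset_Icc_left hx'.1))).const_sub m)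
      (fun x hx hpos => by
        have hx' : x ∈ Icc a b := ⟨hs.1.trans hx.1, hx.2.le⟩
        have hpos' : z x ≤ m := by linarith
        have h1 : H + 1 ≤ k x / m ^ q := by
          rw [le_div_iff₀ hmq0]
          calc (H + 1) * m ^ q ≤ (H + 1) * (k x₀ / (H + 1)) := by gcongr
            _ = k x₀ := by field_simp
            _ ≤ k x := hmin hx'
        have h2 := (abs_le.1 (hH x hx')).2
        simp only [hF, max_eq_right hpos']
        linarith) (by simpa using hlt)
    have h1 : z b = ε := hzb
    have h2 : m ≤ ε := min_le_left _ _
    linarith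
  refine ⟨z, hzb, fun s hs => ⟨hm.trans_le (hzm s hs), ?_⟩⟩
  have := hz s hs
  simpa only [hF, max_eq_left (hzm s hs)] using this

/-- The source of every comparison below: the right-hand side of the equation is nondecreasing in
the unknown. -/
theorem div_rpow_antitone {q k x y : ℝ} (hq : 0 < q) (hk : 0 ≤ k) (hx : 0 < x) (hxy : x ≤ y) :
    k / y ^ q ≤ k / x ^ q :=
  div_le_div_of_nonneg_left hk (Real.rpow_pos_of_pos hx q) (Real.rpow_le_rpow hx.le hxy hq.le)

namespace SolvesOn

variable {q a b : ℝ} {h k z z₁ z₂ : ℝ → ℝ}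

/-- A solution starting (at the right endpoint) below a subsolution stays below it. -/
theorem le_of_subsolution (hq : 0 < q) (hk : ∀ s ∈ Icc a b, 0 < k s)
    (hz : SolvesOn q h k z a b) {w w' : ℝ → ℝ} (hw : ContinuousOn w (Icc a b))
    (hwpos : ∀ s ∈ Icc a b, 0 < w s)
    (hw' : ∀ s ∈ Ico a b, HasDerivWithinAt w (w' s) (Ici s) s)
    (hsub : ∀ s ∈ Ico a b, w' s ≤ h s - k s / w s ^ q) (hb : z b ≤ w b) {s : ℝ}
    (hs : s ∈ Icc a b) : z s ≤ w s := by
  by_contra! hlt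
  -- Where `z > w`, the slope of `z - w` is at least `k / w ^ q - k / z ^ q ≥ 0`, so an excess at
  -- `s` would persist up to `b`.
  have hle := le_of_hasDerivWithinAt_nonneg_of_pos (φ := fun x => z x - w x)
    (φ' := fun x => h x - k x / z x ^ q - w' x) hs.2
    ((hz.continuousOn.sub hw).mono (Icc_subset_Icc_left hs.1))
    (fun x hx => (hz.hasDerivWithinAt_Ici ⟨hs.1.trans hx.1, hx.2⟩).sub
      (hw' x ⟨hs.1.trans hx.1, hx.2⟩))
    (fun x hx hpos => by
      have hx' : x ∈ Ico a b := ⟨hs.1.trans hx.1, hx.2⟩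
      have hx'' := Ico_subset_Icc_self hx'
      have := div_rpow_antitone hq (hk x hx'').le (hwpos x hx'') (sub_pos.1 hpos).le
      have := hsub x hx'
      linarith) (sub_pos.2 hlt)
  linarith

/-- A positive gap between two solutions can only widen to the right, by monotonicity of the field.
Exchanging the solutions turns this into the contraction estimate. -/
theorem sub_le_sub_right_end (hq : 0 < q) (hk : ∀ s ∈ Icc a b, 0 < k s)
    (hz₁ : SolvesOn q h k z₁ a b) (hz₂ : SolvesOn q h k z₂ a b) {s : ℝ} (hs : s ∈ Icc a b)
    (hlt : z₂ s < z₁ s) : z₁ s - z₂ s ≤ z₁ b - z₂ b :=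
  le_of_hasDerivWithinAt_nonneg_of_pos (φ := fun x => z₁ x - z₂ x)
    (φ' := fun x => h x - k x / z₁ x ^ q - (h x - k x / z₂ x ^ q)) hs.2
    ((hz₁.continuousOn.sub hz₂.continuousOn).mono (Icc_subset_Icc_left hs.1))
    (fun x hx => (hz₁.hasDerivWithinAt_Ici ⟨hs.1.trans hx.1, hx.2⟩).sub
      (hz₂.hasDerivWithinAt_Ici ⟨hs.1.trans hx.1, hx.2⟩))
    (fun x hx hpos => by
      have hx' : x ∈ Icc a b := ⟨hs.1.trans hx.1, hx.2.le⟩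
      have := div_rpow_antitone hq (hk x hx').le (hz₂ x hx').1 (sub_pos.1 hpos).le
      linarith) (sub_pos.2 hlt)

/-- The backward flow is a contraction. -/
theorem abs_sub_le (hq : 0 < q) (hk : ∀ s ∈ Icc a b, 0 < k s)
    (hz₁ : SolvesOn q h k z₁ a b) (hz₂ : SolvesOn q h k z₂ a b) {s : ℝ} (hs : s ∈ Icc a b) :
    |z₁ s - z₂ s| ≤ |z₁ b - z₂ b| := by
  rcases lt_trichotomy (z₁ s) (z₂ s) with hlt | heq | hlt
  · rw [abs_sub_comm, abs_of_pos (sub_pos.2 hlt), abs_sub_comm (z₁ b)]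
    exact (sub_le_sub_right_end hq hk hz₂ hz₁ hs hlt).trans (le_abs_self _)
  · simp [heq]
  · rw [abs_of_pos (sub_pos.2 hlt)]
    exact (sub_le_sub_right_end hq hk hz₁ hz₂ hs hlt).trans (le_abs_self _)

/-- A lower bound that is independent of the value at the right endpoint. -/
theorem min_le (hq : 0 < q) (hk : ∀ s ∈ Icc a b, 0 < k s)
    (hz : SolvesOn q h k z a b) {m H : ℝ} (hH : ∀ s ∈ Icc a b, h s ≤ H)
    (hm : ∀ s ∈ Icc a b, H + 1 ≤ k s / m ^ q) {s : ℝ} (hs : s ∈ Icc a b) :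
    min m (b - s) ≤ z s := by
  rcases le_or_gt m (z s) with hle | hlt
  · exact (min_le_left _ _).trans hle
  -- While `z ≤ m` its slope is at most `-1`. Starting below `m`, it therefore loses at least `b -
  -- s` before reaching `b`, where it is still positive.
  have hle := le_of_hasDerivWithinAt_nonneg_of_pos (φ := fun x => m - z x - (x - s))
    (φ' := fun x => -(h x - k x / z x ^ q) - 1) hs.2
    ((continuousOn_const.sub (hz.continuousOn.mono (Icc_subset_Icc_left hs.1))).sub
      (continuousOn_id.sub continuousOn_const))
    (fun x hx => ((hz.hasDerivWithinAt_Ici ⟨hs.1.trans hx.1, hx.2⟩).const_sub m).sub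
      ((hasDerivAt_id x).sub_const s).hasDerivWithinAt)
    (fun x hx hpos => by
      have hx' : x ∈ Icc a b := ⟨hs.1.trans hx.1, hx.2.le⟩
      have hzm : z x ≤ m := by linarith [hx.1]
      have := div_rpow_antitone hq (hk x hx').le (hz x hx').1 hzm
      have := hH x hx'
      have := hm x hx'
      linarith) (by simpa using hlt)
  have := (hz b (right_mem_Icc.2 (hs.1.trans hs.2))).1
  exact (min_le_right _ _).trans (by linarith)

/-- An upper bound near the right endpoint. -/
theorem le_max_add_integral (hq : 0 < q) (hk : ∀ s ∈ Icc a b, 0 < k s)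
    (hkc : ContinuousOn k (Icc a b))
    (hz : SolvesOn q h k z a b) {θ H : ℝ} (hθ : 0 < θ) (hH0 : 0 ≤ H)
    (hH : ∀ s ∈ Icc a b, -H ≤ h s) {s : ℝ} (hs : s ∈ Icc a b) :
    z s ≤ max θ (z b) + ∫ x in s..b, (H + k x / θ ^ q) := by
  have hsb : Icc s b ⊆ Icc a b := Icc_subset_Icc_left hs.1
  have hcont : ContinuousOn (fun x => H + k x / θ ^ q) (Icc s b) :=
    continuousOn_const.add ((hkc.mono hsb).div_const _)
  have hθq : 0 < θ ^ q := Real.rpow_pos_of_pos hθ q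
  have hint0 : 0 ≤ ∫ x in s..b, (H + k x / θ ^ q) :=
    intervalIntegral.integral_nonneg hs.2 fun x hx =>
      add_nonneg hH0 (div_nonneg (hk x (hsb hx)).le hθq.le)
  by_contra! hlt
  have hderiv : ∀ x ∈ Ico s b, HasDerivWithinAt (fun y => ∫ x in s..y, (H + k x / θ ^ q))
      (H + k x / θ ^ q) (Ici x) x := by
    intro x hx
    have hmem : Icc s b ∈ 𝓝[>] x :=
      mem_of_superset (Ioc_mem_nhdsGT hx.2) fun y hy => ⟨hx.1.trans hy.1.le, hy.2⟩
    refine intervalIntegral.integral_hasDerivWithinAt_right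
      ((hcont.mono (Icc_subset_Icc_right hx.2.le)).intervalIntegrable_of_Icc hx.1)
      ⟨Icc s b, hmem, hcont.aestronglyMeasurable measurableSet_Icc⟩ ?_
    exact ((hcont x (Ico_subset_Icc_self hx)).mono_of_mem_nhdsWithin hmem)
  have hprim : ContinuousOn (fun y => ∫ x in s..y, (H + k x / θ ^ q)) (Icc s b) := by
    have := intervalIntegral.continuousOn_primitive_interval (a := s) (b := b) (μ := volume)
      (f := fun x => H + k x / θ ^ q) (by rw [uIcc_of_le hs.2]; exact hcont.integrableOn_Icc)
    rwa [uIcc_of_le hs.2] at this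
  set J := ∫ x in s..b, (H + k x / θ ^ q) with hJ
  -- Positivity of this function forces `z ≥ θ`, since the partial integral is at most `J`; there `k
  -- / z ^ q ≤ k / θ ^ q`, so the added integrand outweighs any decrease of `z`.
  have hle := le_of_hasDerivWithinAt_nonneg_of_pos
    (φ := fun x => z x - θ - J + ∫ y in s..x, (H + k y / θ ^ q))
    (φ' := fun x => h x - k x / z x ^ q + (H + k x / θ ^ q)) hs.2
    ((((hz.continuousOn.mono hsb).sub continuousOn_const).sub continuousOn_const).add hprim)
    (fun x hx => (((hz.hasDerivWithinAt_Ici ⟨hs.1.trans hx.1, hx.2⟩).sub_const θ).sub_const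
      J).add (hderiv x hx))
    (fun x hx hpos => by
      have hx' : x ∈ Icc a b := ⟨hs.1.trans hx.1, hx.2.le⟩
      have hxJ : ∫ y in s..x, (H + k y / θ ^ q) ≤ J :=
        intervalIntegral.integral_mono_interval le_rfl hx.1 hx.2.le
          ((ae_restrict_iff' measurableSet_Ioc).2 (ae_of_all _ fun y hy =>
            add_nonneg hH0 (div_nonneg (hk y (hsb (Ioc_subset_Icc_self hy))).le hθq.le)))
          (hcont.intervalIntegrable_of_Icc hs.2)
      have hzθ : θ ≤ z x := by linarith
      have := div_rpow_antitone hq (hk x hx').le hθ hzθ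
      have := hH x hx'
      linarith)
    (by
      have := le_max_left θ (z b)
      simp only [intervalIntegral.integral_same]
      linarith)
  have := le_max_right θ (z b)
  have hle' : z s - θ - J + ∫ y in s..s, (H + k y / θ ^ q) ≤
    z b - θ - J + ∫ y in s..b, (H + k y / θ ^ q) := hle
  rw [intervalIntegral.integral_same, ← hJ] at hle'
  linarith

end SolvesOn

/-! ### Profiles and their construction from a subsolution -/

/-- A positive solution of `z' = h - k / z ^ q` on `(0, 1)` vanishing at both endpoints. -/
structure IsProfile (q : ℝ) (h k z : ℝ → ℝ) : Prop where
  pos : ∀ s ∈ Ioo (0 : ℝ) 1, 0 < z s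
  hasDerivAt : ∀ s ∈ Ioo (0 : ℝ) 1, HasDerivAt z (h s - k s / z s ^ q) s
  tendsto_zero : Tendsto z (𝓝[>] 0) (𝓝 0)
  tendsto_one : Tendsto z (𝓝[<] 1) (𝓝 0)

/-- Pointwise limits of locally uniformly positive solutions are solutions. -/
theorem hasDerivAt_of_tendsto_solvesOn {q : ℝ} {h k Z : ℝ → ℝ} {z : ℕ → ℝ → ℝ} (hq : 0 < q)
    (hh : ContinuousOn h (Ioo 0 1)) (hk : ContinuousOn k (Ioo 0 1))
    (hz : ∀ A B : ℝ, 0 < A → A ≤ B → B < 1 → ∀ᶠ n in atTop, SolvesOn q h k (z n) A B)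
    (hlow : ∀ A B : ℝ, 0 < A → A ≤ B → B < 1 →
      ∃ m : ℝ, 0 < m ∧ ∀ᶠ n in atTop, ∀ s ∈ Icc A B, m ≤ z n s)
    (hlim : ∀ s ∈ Ioo (0 : ℝ) 1, Tendsto (fun n => z n s) atTop (𝓝 (Z s)))
    (hZ : ContinuousOn Z (Ioo 0 1)) (hZpos : ∀ s ∈ Ioo (0 : ℝ) 1, 0 < Z s) {s : ℝ}
    (hs : s ∈ Ioo (0 : ℝ) 1) : HasDerivAt Z (h s - k s / Z s ^ q) s := by
  have hcontF : ContinuousOn (fun x => h x - k x / Z x ^ q) (Ioo 0 1) :=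
    hh.sub (hk.div (hZ.rpow_const fun x hx => Or.inl (hZpos x hx).ne')
      fun x hx => (Real.rpow_pos_of_pos (hZpos x hx) q).ne')
  -- The integrated equation passes to the limit by dominated convergence, the uniform lower bound
  -- `m` keeping the singular term bounded.
  have hint : ∀ A B : ℝ, 0 < A → A ≤ B → B < 1 →
      ∫ x in A..B, (h x - k x / Z x ^ q) = Z B - Z A := by
    intro A B hA hAB hB
    have hsub : Icc A B ⊆ Ioo (0 : ℝ) 1 := fun x hx => ⟨hA.trans_le hx.1, hx.2.trans_lt hB⟩
    obtain ⟨m, hm, hmz⟩ := hlow A B hA hAB hB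
    obtain ⟨H, hH⟩ := isCompact_Icc.exists_bound_of_continuousOn (hh.mono hsub)
    obtain ⟨K, hK⟩ := isCompact_Icc.exists_bound_of_continuousOn (hk.mono hsub)
    have hcn : ∀ n, SolvesOn q h k (z n) A B →
        ContinuousOn (fun x => h x - k x / z n x ^ q) (Icc A B) := fun n hn =>
      (hh.mono hsub).sub ((hk.mono hsub).div
        (hn.continuousOn.rpow_const fun x hx => Or.inl (hn x hx).1.ne')
        fun x hx => (Real.rpow_pos_of_pos (hn x hx).1 q).ne')
    have h1 : Tendsto (fun n => ∫ x in A..B, (h x - k x / z n x ^ q)) atTop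
        (𝓝 (∫ x in A..B, (h x - k x / Z x ^ q))) := by
      refine intervalIntegral.tendsto_integral_filter_of_dominated_convergence
        (fun _ => H + K / m ^ q) ?_ ?_ intervalIntegrable_const ?_
      · filter_upwards [hz A B hA hAB hB] with n hn
        rw [uIoc_of_le hAB]
        exact ((hcn n hn).mono Ioc_subset_Icc_self).aestronglyMeasurable measurableSet_Ioc
      · filter_upwards [hmz] with n hn
        refine ae_of_all _ fun x hx => ?_
        rw [uIoc_of_le hAB] at hx
        have hx' := Ioc_subset_Icc_self hx
        refine (norm_sub_le _ _).trans (add_le_add (hH x hx') ?_)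
        rw [norm_div, Real.norm_of_nonneg (Real.rpow_nonneg (hm.le.trans (hn x hx')) q)]
        exact div_le_div₀ ((norm_nonneg _).trans (hK x hx')) (hK x hx')
          (Real.rpow_pos_of_pos hm q) (Real.rpow_le_rpow hm.le (hn x hx') hq.le)
      · refine ae_of_all _ fun x hx => ?_
        rw [uIoc_of_le hAB] at hx
        have hx' := hsub (Ioc_subset_Icc_self hx)
        have h0 := hZpos x hx'
        exact tendsto_const_nhds.sub (tendsto_const_nhds.div
          ((hlim x hx').rpow_const (Or.inl h0.ne')) (Real.rpow_pos_of_pos h0 q).ne')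
    have h2 : Tendsto (fun n => ∫ x in A..B, (h x - k x / z n x ^ q)) atTop (𝓝 (Z B - Z A)) := by
      refine ((hlim B (hsub (right_mem_Icc.2 hAB))).sub
        (hlim A (hsub (left_mem_Icc.2 hAB)))).congr' ?_
      filter_upwards [hz A B hA hAB hB] with n hn
      exact (intervalIntegral.integral_eq_sub_of_hasDerivAt_of_le hAB hn.continuousOn
        (fun x hx => hn.hasDerivAt hx) ((hcn n hn).intervalIntegrable_of_Icc hAB)).symm
    exact tendsto_nhds_unique h1 h2
  have hA : 0 < s / 2 := half_pos hs.1
  have hAs : s / 2 < s := half_lt_self hs.1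
  have hsub : uIcc (s / 2) s ⊆ Ioo (0 : ℝ) 1 := by
    rw [uIcc_of_le hAs.le]
    exact fun x hx => ⟨hA.trans_le hx.1, hx.2.trans_lt hs.2⟩
  have hD : HasDerivAt (fun y => Z (s / 2) + ∫ x in (s / 2)..y, (h x - k x / Z x ^ q))
      (h s - k s / Z s ^ q) s :=
    (intervalIntegral.integral_hasDerivAt_right (hcontF.mono hsub).intervalIntegrable
      (hcontF.stronglyMeasurableAtFilter isOpen_Ioo s hs)
      (hcontF.continuousAt (isOpen_Ioo.mem_nhds hs))).const_add _
  refine hD.congr_of_eventuallyEq ?_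
  filter_upwards [Ioo_mem_nhds hAs hs.2] with y hy
  rw [hint _ _ hA hy.1.le hy.2]
  ring

/-- A positive subsolution vanishing at `0` forces the existence of a profile. -/
theorem exists_isProfile {q : ℝ} {h k w w' : ℝ → ℝ} (hq : 0 < q)
    (hh : ContinuousOn h (Icc 0 1)) (hk : ContinuousOn k (Ioo 0 1))
    (hkpos : ∀ s ∈ Ioo (0 : ℝ) 1, 0 < k s) (hkint : IntegrableOn k (Ioo 0 1))
    (hw : ContinuousOn w (Ioo 0 1)) (hwpos : ∀ s ∈ Ioo (0 : ℝ) 1, 0 < w s)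
    (hw' : ∀ s ∈ Ioo (0 : ℝ) 1, HasDerivWithinAt w (w' s) (Ici s) s)
    (hsub : ∀ s ∈ Ioo (0 : ℝ) 1, w' s ≤ h s - k s / w s ^ q)
    (hw0 : Tendsto w (𝓝[>] 0) (𝓝 0)) : ∃ z, IsProfile q h k z := by
  obtain ⟨H, hH⟩ := isCompact_Icc.exists_bound_of_continuousOn hh
  have hH0 : 0 ≤ H := (norm_nonneg _).trans (hH 0 (by simp))
  -- The shift by `3` keeps `δ n ≤ 1 / 3`, so the exhausting intervals `[δ n, 1 - δ n]` are
  -- nondegenerate.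
  set δ : ℕ → ℝ := fun n => 1 / ((n : ℝ) + 3) with hδ
  have hδpos : ∀ n, 0 < δ n := fun n => by positivity
  have hδle : ∀ n, δ n ≤ 1 / 3 := fun n => by
    refine one_div_le_one_div_of_le (by norm_num) ?_
    have : (0 : ℝ) ≤ n := n.cast_nonneg
    linarith
  have hδanti : ∀ m n, m ≤ n → δ n ≤ δ m := fun m n hmn => by
    refine one_div_le_one_div_of_le (by positivity) ?_
    have : (m : ℝ) ≤ n := Nat.cast_le.2 hmn
    linarith
  have hδlim : Tendsto δ atTop (𝓝 0) := by
    have h1 : Tendsto (fun n : ℕ => (n : ℝ) + 3) atTop atTop :=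
      tendsto_atTop_add_const_right _ _ tendsto_natCast_atTop_atTop
    simp only [hδ, one_div]
    exact h1.inv_tendsto_atTop
  have hmem : ∀ n, ∀ s ∈ Icc (δ n) (1 - δ n), s ∈ Ioo (0 : ℝ) 1 := fun n s hs =>
    ⟨(hδpos n).trans_le hs.1, hs.2.trans_lt (by linarith [hδpos n])⟩
  have hbmem : ∀ m n, m ≤ n → 1 - δ m ∈ Icc (δ n) (1 - δ n) := fun m n hmn => by
    have := hδanti m n hmn
    have := hδle m
    exact ⟨by linarith, by linarith⟩
  -- The terminal value lies below `w`, to start the comparison, and below `δ n`, so that the limit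
  -- vanishes at `1`.
  have hex : ∀ n, ∃ z, z (1 - δ n) = min (δ n) (w (1 - δ n)) ∧
      SolvesOn q h k z (δ n) (1 - δ n) := fun n =>
    exists_solvesOn hq (hbmem n n le_rfl).1
      (hh.mono fun s hs => Ioo_subset_Icc_self (hmem n s hs)) (hk.mono (hmem n))
      (fun s hs => hkpos s (hmem n s hs))
      (lt_min (hδpos n) (hwpos _ (hmem n _ (hbmem n n le_rfl))))
  choose z hzb hz using hex
  have hkn : ∀ n, ∀ s ∈ Icc (δ n) (1 - δ n), 0 < k s := fun n s hs => hkpos s (hmem n s hs)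
  have hzw : ∀ n, ∀ s ∈ Icc (δ n) (1 - δ n), z n s ≤ w s := fun n s hs =>
    (hz n).le_of_subsolution hq (hkn n) (hw.mono (hmem n)) (fun s hs => hwpos s (hmem n s hs))
      (fun s hs => hw' s (hmem n s (Ico_subset_Icc_self hs)))
      (fun s hs => hsub s (hmem n s (Ico_subset_Icc_self hs)))
      (by rw [hzb]; exact min_le_right _ _) hs
  set J : ℝ → ℝ → ℝ := fun θ s => ∫ x in s..1, (H + k x / θ ^ q) with hJ
  have hJint : ∀ θ, IntegrableOn (fun x => H + k x / θ ^ q) (Icc 0 1) := fun θ => by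
    rw [integrableOn_Icc_iff_integrableOn_Ioo]
    exact (integrableOn_const (by simp)).add (hkint.div_const _)
  have hJlim : ∀ θ, Tendsto (J θ) (𝓝[<] 1) (𝓝 0) := fun θ => by
    have h1 := intervalIntegral.continuousOn_primitive_interval_left (a := 0) (b := 1)
      (f := fun x => H + k x / θ ^ q) (μ := volume) (by rw [uIcc_of_le zero_le_one]; exact hJint θ)
    rw [uIcc_of_le zero_le_one] at h1
    have h2 := (h1 1 (by simp)).tendsto
    rw [intervalIntegral.integral_same] at h2
    refine h2.mono_left ?_
    rw [nhdsWithin_le_iff]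
    exact mem_of_superset (Ioo_mem_nhdsLT zero_lt_one) Ioo_subset_Icc_self
  -- Integrability of `k` makes `J θ` small near `1`; this bound is uniform in `n` apart from `δ n`.
  have hup : ∀ θ, 0 < θ → ∀ n, ∀ s ∈ Icc (δ n) (1 - δ n), z n s ≤ max θ (δ n) + J θ s := by
    intro θ hθ n s hs
    have hs' := hmem n s hs
    have h1 := (hz n).le_max_add_integral hq (hkn n) (hk.mono (hmem n)) hθ hH0
      (fun x hx => (abs_le.1 (hH x (Ioo_subset_Icc_self (hmem n x hx)))).1) hs
    refine h1.trans (add_le_add (max_le_max le_rfl (by rw [hzb]; exact min_le_left _ _)) ?_)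
    refine intervalIntegral.integral_mono_interval le_rfl hs.2 (by linarith [hδpos n]) ?_ ?_
    · rw [EventuallyLE, ae_restrict_iff' measurableSet_Ioc]
      filter_upwards [Measure.ae_ne volume (1 : ℝ)] with x hx1 hx
      exact add_nonneg hH0 (div_nonneg (hkpos x ⟨hs'.1.trans hx.1, lt_of_le_of_ne hx.2 hx1⟩).le
        (Real.rpow_nonneg hθ.le q))
    · rw [intervalIntegrable_iff_integrableOn_Icc_of_le hs'.2.le]
      exact (hJint θ).mono_set (Icc_subset_Icc_left hs'.1.le)
  have hsmall : ∀ η : ℝ, 0 < η → ∃ N, ∀ n, N ≤ n → ∀ m, n ≤ m → z m (1 - δ n) ≤ η := by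
    intro η hη
    have hb : Tendsto (fun n => 1 - δ n) atTop (𝓝[<] 1) := by
      refine tendsto_nhdsWithin_iff.2 ⟨?_, Eventually.of_forall fun n => ?_⟩
      · simpa using hδlim.const_sub 1
      · have := hδpos n
        simpa using this
    have h1 := ((hJlim (η / 2)).comp hb).eventually (ge_mem_nhds (half_pos hη))
    have h2 := hδlim.eventually (ge_mem_nhds (half_pos hη))
    obtain ⟨N, hN⟩ := eventually_atTop.1 (h1.and h2)
    refine ⟨N, fun n hn m hnm => ?_⟩
    have h3 := hup (η / 2) (half_pos hη) m _ (hbmem n m hnm)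
    have h4 : J (η / 2) (1 - δ n) ≤ η / 2 := (hN n hn).1
    have h5 : max (η / 2) (δ m) ≤ η / 2 := max_le le_rfl (hN m (hn.trans hnm)).2
    linarith
  -- By backward contraction the difference is controlled by its value at `1 - δ n`, where both
  -- solutions are positive and at most `η`.
  have hcauchy : ∀ η : ℝ, 0 < η → ∃ N, ∀ n, N ≤ n → ∀ m, n ≤ m →
      ∀ s ∈ Icc (δ n) (1 - δ n), |z m s - z n s| ≤ η := by
    intro η hη
    obtain ⟨N, hN⟩ := hsmall η hη
    refine ⟨N, fun n hn m hnm s hs => ?_⟩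
    have hd := hδanti n m hnm
    refine (((hz m).mono hd (by linarith)).abs_sub_le hq (hkn n) (hz n) hs).trans ?_
    have h1 := hN n hn m hnm
    have h2 := hN n hn n le_rfl
    have h3 := (hz m _ (hbmem n m hnm)).1
    have h4 := (hz n _ (hbmem n n le_rfl)).1
    exact abs_le.2 ⟨by linarith, by linarith⟩
  have hIcc : ∀ A B : ℝ, 0 < A → B < 1 → ∀ᶠ n in atTop, δ n ≤ A ∧ B ≤ 1 - δ n := by
    intro A B hA hB
    filter_upwards [hδlim.eventually (ge_mem_nhds hA),
      hδlim.eventually (ge_mem_nhds (sub_pos.2 hB))] with n h1 h2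
    exact ⟨h1, by linarith⟩
  have hconv : ∀ s, s ∈ Ioo (0 : ℝ) 1 → ∃ l, Tendsto (fun n => z n s) atTop (𝓝 l) := by
    intro s hs
    refine cauchySeq_tendsto_of_complete (Metric.cauchySeq_iff'.2 fun η hη => ?_)
    obtain ⟨N, hN⟩ := hcauchy (η / 2) (half_pos hη)
    obtain ⟨n, hnN, hn⟩ := ((eventually_ge_atTop N).and (hIcc s s hs.1 hs.2)).exists
    exact ⟨n, fun m hm => (hN n hnN m hm s hn).trans_lt (half_lt_self hη)⟩
  choose! Z hZ using hconv
  have hunif : ∀ A B : ℝ, 0 < A → B < 1 → TendstoUniformlyOn z Z atTop (Icc A B) := by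
    intro A B hA hB
    rw [Metric.tendstoUniformlyOn_iff]
    intro η hη
    obtain ⟨N, hN⟩ := hcauchy (η / 2) (half_pos hη)
    filter_upwards [eventually_ge_atTop N, hIcc A B hA hB] with n hn hn' s hs
    have hs' : s ∈ Icc (δ n) (1 - δ n) := ⟨hn'.1.trans hs.1, hs.2.trans hn'.2⟩
    have h1 : Tendsto (fun m => |z m s - z n s|) atTop (𝓝 |Z s - z n s|) :=
      ((hZ s (hmem n s hs')).sub_const _).abs
    refine (le_of_tendsto h1 ?_ : dist (Z s) (z n s) ≤ η / 2).trans_lt (half_lt_self hη)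
    filter_upwards [eventually_ge_atTop n] with m hm using hN n hn m hm s hs'
  have hsolv : ∀ A B : ℝ, 0 < A → A ≤ B → B < 1 → ∀ᶠ n in atTop, SolvesOn q h k (z n) A B := by
    intro A B hA _ hB
    filter_upwards [hIcc A B hA hB] with n hn using (hz n).mono hn.1 hn.2
  have hcont : ContinuousOn Z (Ioo 0 1) := by
    intro s hs
    have h1 : ContinuousOn Z (Icc (s / 2) ((s + 1) / 2)) :=
      (hunif _ _ (half_pos hs.1) (by linarith [hs.2])).continuousOn
        ((hsolv _ _ (half_pos hs.1) (by linarith [hs.2]) (by linarith [hs.2])).mono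
          fun n hn => hn.continuousOn).frequently
    exact (h1.continuousAt (Icc_mem_nhds (by linarith [hs.1])
      (by linarith [hs.2]))).continuousWithinAt
  have hlow : ∀ A B : ℝ, 0 < A → A ≤ B → B < 1 →
      ∃ m : ℝ, 0 < m ∧ ∀ᶠ n in atTop, ∀ s ∈ Icc A B, m ≤ z n s := by
    intro A B hA hAB hB
    -- `SolvesOn.min_le` degenerates at the right endpoint, so some room is left beyond `B`.
    set B' := (B + 1) / 2 with hB'
    have hBB' : B < B' := by rw [hB']; linarith
    have hB'1 : B' < 1 := by rw [hB']; linarith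
    have hsub' : Icc A B' ⊆ Ioo (0 : ℝ) 1 := fun x hx => ⟨hA.trans_le hx.1, hx.2.trans_lt hB'1⟩
    obtain ⟨x₀, hx₀, hmin⟩ := isCompact_Icc.exists_isMinOn
      (nonempty_Icc.2 (hAB.trans hBB'.le)) (hk.mono hsub')
    have hk₀ := hkpos x₀ (hsub' hx₀)
    set m := (k x₀ / (H + 1)) ^ (1 / q) with hm_def
    have hm : 0 < m := by positivity
    have hmq : m ^ q = k x₀ / (H + 1) := by
      rw [hm_def, ← Real.rpow_mul (by positivity), one_div_mul_cancel hq.ne', Real.rpow_one]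
    refine ⟨min m (B' - B), lt_min hm (sub_pos.2 hBB'), ?_⟩
    filter_upwards [hsolv A B' hA (hAB.trans hBB'.le) hB'1] with n hn s hs
    refine (min_le_min le_rfl (by linarith [hs.2])).trans (hn.min_le hq
      (fun x hx => hkpos x (hsub' hx)) (H := H)
      (fun x hx => (abs_le.1 (hH x (Ioo_subset_Icc_self (hsub' hx)))).2) (fun x hx => ?_)
      ⟨hs.1, hs.2.trans hBB'.le⟩)
    rw [hmq, le_div_iff₀ (by positivity)]
    calc (H + 1) * (k x₀ / (H + 1)) = k x₀ := by field_simp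
      _ ≤ k x := hmin hx
  have hZpos : ∀ s ∈ Ioo (0 : ℝ) 1, 0 < Z s := by
    intro s hs
    obtain ⟨m, hm, hmz⟩ := hlow s s hs.1 le_rfl hs.2
    exact hm.trans_le (ge_of_tendsto (hZ s hs) (hmz.mono fun n hn => hn s ⟨le_rfl, le_rfl⟩))
  refine ⟨Z, hZpos, fun s hs => hasDerivAt_of_tendsto_solvesOn hq
    (hh.mono Ioo_subset_Icc_self) hk hsolv hlow hZ hcont hZpos hs, ?_, ?_⟩
  · refine tendsto_of_tendsto_of_tendsto_of_le_of_le' tendsto_const_nhds hw0 ?_ ?_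
    · filter_upwards [Ioo_mem_nhdsGT zero_lt_one] with s hs using (hZpos s hs).le
    · filter_upwards [Ioo_mem_nhdsGT zero_lt_one] with s hs
      exact le_of_tendsto (hZ s hs) ((hIcc s s hs.1 hs.2).mono fun n hn => hzw n s hn)
  · have hZup : ∀ θ, 0 < θ → ∀ s ∈ Ioo (0 : ℝ) 1, Z s ≤ θ + J θ s := by
      intro θ hθ s hs
      refine le_of_tendsto (hZ s hs) ?_
      filter_upwards [hIcc s s hs.1 hs.2, hδlim.eventually (ge_mem_nhds hθ)] with n hn hn'
      have := hup θ hθ n s hn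
      rwa [max_eq_left hn'] at this
    rw [tendsto_order]
    refine ⟨fun c hc => ?_, fun c hc => ?_⟩
    · filter_upwards [Ioo_mem_nhdsLT zero_lt_one] with s hs using hc.trans (hZpos s hs)
    · filter_upwards [Ioo_mem_nhdsLT zero_lt_one,
        (hJlim (c / 2)).eventually (gt_mem_nhds (half_pos hc))] with s hs hs'
      linarith [hZup (c / 2) (half_pos hc) s hs]

/-! ### Intervals with extended real endpoints -/

section Interval

variable {α β : EReal}

theorem isOpen_openInterval (α β : EReal) : IsOpen (openInterval α β) :=
  (isOpen_Ioo (a := α) (b := β)).preimage continuous_coe_real_ereal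

theorem ordConnected_openInterval (α β : EReal) : (openInterval α β).OrdConnected :=
  ⟨fun _ hx _ hy _ hz =>
    ⟨hx.1.trans_le (EReal.coe_le_coe_iff.2 hz.1), (EReal.coe_le_coe_iff.2 hz.2).trans_lt hy.2⟩⟩

theorem eventually_rightOf {t : ℝ} (ht : α < t) :
    ∀ᶠ x : ℝ in rightOf α, α < (x : EReal) ∧ x < t := by
  refine ⟨Ioo α t, Ioo_mem_nhdsGT ht, fun x hx => ⟨hx.1, EReal.coe_lt_coe_iff.1 hx.2⟩⟩

theorem eventually_leftOf {t : ℝ} (ht : (t : EReal) < β) :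
    ∀ᶠ x : ℝ in leftOf β, t < x ∧ (x : EReal) < β := by
  refine ⟨Ioo t β, Ioo_mem_nhdsLT ht, fun x hx => ⟨EReal.coe_lt_coe_iff.1 hx.1, hx.2⟩⟩

theorem eventually_mem_rightOf (h : α < β) : ∀ᶠ x in rightOf α, x ∈ openInterval α β := by
  obtain ⟨t, h1, h2⟩ := EReal.lt_iff_exists_real_btwn.1 h
  exact (eventually_rightOf h1).mono fun x hx => ⟨hx.1, (EReal.coe_lt_coe_iff.2 hx.2).trans h2⟩

theorem eventually_mem_leftOf (h : α < β) : ∀ᶠ x in leftOf β, x ∈ openInterval α β := by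
  obtain ⟨t, h1, h2⟩ := EReal.lt_iff_exists_real_btwn.1 h
  exact (eventually_leftOf h2).mono fun x hx => ⟨h1.trans (EReal.coe_lt_coe_iff.2 hx.1), hx.2⟩

theorem neBot_rightOf (h : α < β) : (rightOf α).NeBot := by
  refine comap_neBot fun s hs => ?_
  obtain ⟨b, hb, hsub⟩ := (mem_nhdsGT_iff_exists_Ioo_subset' h).1 hs
  obtain ⟨t, h1, h2⟩ := EReal.lt_iff_exists_real_btwn.1 hb
  exact ⟨t, hsub ⟨h1, h2⟩⟩

theorem neBot_leftOf (h : α < β) : (leftOf β).NeBot := by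
  refine comap_neBot fun s hs => ?_
  obtain ⟨b, hb, hsub⟩ := (mem_nhdsLT_iff_exists_Ioo_subset' h).1 hs
  obtain ⟨t, h1, h2⟩ := EReal.lt_iff_exists_real_btwn.1 hb
  exact ⟨t, hsub ⟨h1, h2⟩⟩

end Interval

/-! ### Derivatives and inverse functions -/

theorem contDiffOn_one_of_hasDerivAt {S : Set ℝ} (hS : IsOpen S) {f f' : ℝ → ℝ}
    (hf : ∀ x ∈ S, HasDerivAt f (f' x) x) (hf' : ContinuousOn f' S) : ContDiffOn ℝ 1 f S := by
  have h := (contDiffOn_succ_iff_deriv_of_isOpen (𝕜 := ℝ) (n := 0) (f := f) hS).2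
    ⟨fun x hx => (hf x hx).differentiableAt.differentiableWithinAt, by simp,
      contDiffOn_zero.2 (hf'.congr fun x hx => (hf x hx).deriv)⟩
  simpa using h

theorem hasDerivAt_of_contDiffOn_one {S : Set ℝ} (hS : IsOpen S) {f : ℝ → ℝ}
    (hf : ContDiffOn ℝ 1 f S) {x : ℝ} (hx : x ∈ S) : HasDerivAt f (deriv f x) x :=
  ((hf.differentiableOn one_ne_zero x hx).differentiableAt (hS.mem_nhds hx)).hasDerivAt

/-- The inverse of a strictly decreasing differentiable bijection between open sets. -/
theorem hasDerivAt_inverse_of_strictAntiOn {A B : Set ℝ} (hA : IsOpen A) (hB : IsOpen B)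
    {F F' G : ℝ → ℝ} (hF : StrictAntiOn F A) (hAB : MapsTo F A B) (hBA : MapsTo G B A)
    (hFG : ∀ y ∈ B, F (G y) = y) (hF' : ∀ x ∈ A, HasDerivAt F (F' x) x)
    (hne : ∀ x ∈ A, F' x ≠ 0) {y : ℝ} (hy : y ∈ B) : HasDerivAt G (F' (G y))⁻¹ y := by
  have hGF : ∀ x ∈ A, G (F x) = x := fun x hx =>
    hF.injOn (hBA (hAB hx)) hx (hFG _ (hAB hx))
  -- A monotone function whose image is a neighbourhood of the value is continuous there; the sign
  -- turns the decreasing inverse into an increasing one.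
  have hG : MonotoneOn (fun y => -G y) B := fun a ha b hb hab => by
    by_contra! hlt
    have := hF (hBA ha) (hBA hb) (neg_lt_neg_iff.1 hlt)
    rw [hFG a ha, hFG b hb] at this
    exact absurd hab this.not_ge
  have himg : (fun y => -G y) '' B = Neg.neg ⁻¹' A := by
    ext x
    constructor
    · rintro ⟨b, hb, rfl⟩
      simpa using hBA hb
    · intro hx
      exact ⟨F (-x), hAB hx, by simp [hGF _ hx]⟩
  have hcont : ContinuousAt (fun y => -G y) y := by
    refine continuousAt_of_monotoneOn_of_image_mem_nhds hG (hB.mem_nhds hy) ?_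
    rw [himg]
    exact (hA.preimage continuous_neg).mem_nhds (by simpa using hBA hy)
  have hGc : ContinuousAt G y := (hcont.neg).congr (Eventually.of_forall fun x => neg_neg (G x))
  refine HasDerivAt.of_local_left_inverse hGc (hF' _ (hBA hy))
    (hne _ (hBA hy)) ?_
  filter_upwards [hB.mem_nhds hy] with b hb using hFG b hb

/-! ### From waves to profiles -/

section Profile

variable {p c : ℝ} {f g d ρ : ℝ → ℝ}

theorem IsMonostable.inv_pos (hc : IsMonostable p f g d ρ) : 0 < 1 / (p - 1) :=
  one_div_pos.2 (sub_pos.2 hc.one_lt_p)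

theorem IsMonostable.continuousOn_d (hc : IsMonostable p f g d ρ) : ContinuousOn d (Ioo 0 1) :=
  hc.contDiffOn_d.continuousOn

theorem IsMonostable.continuousOn_reaction_mul (hc : IsMonostable p f g d ρ) :
    ContinuousOn (fun s => ρ s * d s ^ (1 / (p - 1))) (Ioo 0 1) :=
  (hc.continuousOn_reaction.mono Ioo_subset_Icc_self).mul
    (hc.continuousOn_d.rpow_const fun _ _ => Or.inr hc.inv_pos.le)

theorem IsMonostable.reaction_mul_pos (hc : IsMonostable p f g d ρ) {s : ℝ}
    (hs : s ∈ Ioo (0 : ℝ) 1) : 0 < ρ s * d s ^ (1 / (p - 1)) :=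
  mul_pos (hc.reaction_pos s hs) (Real.rpow_pos_of_pos (hc.d_pos s hs) _)

theorem IsMonostable.continuousOn_drift (hc : IsMonostable p f g d ρ) (c : ℝ) :
    ContinuousOn (fun s => c * g s - f s) (Icc 0 1) :=
  (continuousOn_const.mul hc.continuousOn_g).sub hc.continuousOn_f

theorem flux_neg_iff {u : ℝ → ℝ} {t : ℝ} (hd : 0 < d (u t)) :
    flux p d u t < 0 ↔ deriv u t < 0 := by
  unfold flux
  constructor
  · intro h
    by_contra! h0
    exact absurd h (mul_nonneg (by positivity) h0).not_gt
  · intro h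
    exact mul_neg_of_pos_of_neg (mul_pos hd (Real.rpow_pos_of_pos (abs_pos.2 h.ne) _)) h

theorem deriv_nonneg_of_flux_nonneg {u : ℝ → ℝ} {t : ℝ} (hd : 0 < d (u t))
    (h : 0 ≤ flux p d u t) : 0 ≤ deriv u t := by
  by_contra! h0
  exact absurd h ((flux_neg_iff hd).2 h0).not_ge

/-- This inverts `-flux = d |u'| ^ (p - 1)`, expressing the speed of descent through the profile. -/
theorem deriv_eq_of_flux_neg (hp : 1 < p) {u : ℝ → ℝ} {t : ℝ} (hd : 0 < d (u t))
    (h : flux p d u t < 0) :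
    deriv u t = -((-flux p d u t) ^ (1 / (p - 1)) / d (u t) ^ (1 / (p - 1))) := by
  have h0 := (flux_neg_iff hd).1 h
  have hp1 : p - 1 ≠ 0 := (sub_pos.2 hp).ne'
  have h1 : -flux p d u t = d (u t) * |deriv u t| ^ (p - 1) := by
    have e : p - 1 = (p - 2) + 1 := by ring
    rw [flux, e, Real.rpow_add_one (abs_pos.2 h0.ne).ne', abs_of_neg h0]
    ring
  rw [h1, Real.mul_rpow hd.le (by positivity), ← Real.rpow_mul (abs_nonneg _),
    mul_one_div_cancel hp1, Real.rpow_one, mul_div_cancel_left₀ _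
      (Real.rpow_pos_of_pos hd _).ne', abs_of_neg h0, neg_neg]

end Profile

namespace IsTravelingWave

variable {p c : ℝ} {f g d ρ : ℝ → ℝ} {α β : EReal} {u : ℝ → ℝ}

theorem hasDerivAt (hu : IsTravelingWave p f g d ρ c α β u) {t : ℝ}
    (ht : t ∈ openInterval α β) : HasDerivAt u (deriv u t) t :=
  hasDerivAt_of_contDiffOn_one (isOpen_openInterval α β) hu.contDiffOn ht

theorem hasDerivAt_flux (hu : IsTravelingWave p f g d ρ c α β u) {t : ℝ}
    (ht : t ∈ openInterval α β) : HasDerivAt (flux p d u) (deriv (flux p d u) t) t :=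
  hasDerivAt_of_contDiffOn_one (isOpen_openInterval α β) hu.contDiffOn_flux ht

/-- At a zero of the flux the equation reads `flux' = -ρ < 0`, so zeros are crossed only downward. A
nonnegative value at `t` thus forces positivity on all of `(α, t)`; then `u` is nondecreasing up to
`t`, and its limit `1` at `α` gives `u t ≥ 1`. -/
theorem flux_neg (hc : IsMonostable p f g d ρ) (hu : IsTravelingWave p f g d ρ c α β u) {t : ℝ}
    (ht : t ∈ openInterval α β) : flux p d u t < 0 := by
  have hord := ordConnected_openInterval α β
  have hzero : ∀ x ∈ openInterval α β, flux p d u x = 0 → deriv (flux p d u) x < 0 := by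
    intro x hx h0
    have hd := hc.d_pos _ (hu.mem_Ioo x hx)
    have h1 : deriv u x = 0 := by
      by_contra hne
      refine absurd h0 (mul_ne_zero (mul_pos hd ?_).ne' hne)
      exact Real.rpow_pos_of_pos (abs_pos.2 hne) _
    have h2 := hu.equation x hx
    have h3 := hc.reaction_pos _ (hu.mem_Ioo x hx)
    rw [h1] at h2
    linarith
  by_contra! hge
  -- Once nonpositive, the flux stays so up to `t`; it would vanish at `t` with negative slope,
  -- hence be positive just before `t`.
  have hpos : ∀ x ∈ openInterval α β, x < t → 0 < flux p d u x := by
    intro x hx hxt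
    by_contra! hle
    have hIcc : Icc x t ⊆ openInterval α β := hord.out hx ht
    have hnonpos := image_le_of_deriv_right_lt_deriv_boundary (f := flux p d u)
      (f' := deriv (flux p d u)) (a := x) (b := t) (B := fun _ => 0) (B' := fun _ => 0)
      (hu.contDiffOn_flux.continuousOn.mono hIcc)
      (fun y hy => (hu.hasDerivAt_flux (hIcc (Ico_subset_Icc_self hy))).hasDerivWithinAt)
      hle (fun y => hasDerivAt_const y 0)
      (fun y hy h0 => hzero y (hIcc (Ico_subset_Icc_self hy)) h0)
    have h0 : flux p d u t = 0 := le_antisymm (hnonpos (right_mem_Icc.2 hxt.le)) hge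
    have hD := hzero t ht h0
    have hslope : ∀ᶠ y in 𝓝[<] t, slope (flux p d u) t y < 0 :=
      ((hasDerivAt_iff_tendsto_slope.1 (hu.hasDerivAt_flux ht)).mono_left
        (nhdsWithin_mono t fun y (hy : y < t) => hy.ne)).eventually (gt_mem_nhds hD)
    obtain ⟨y, hy, hxy, hyt⟩ := (hslope.and (Ioo_mem_nhdsLT hxt)).exists
    have h3 := hnonpos (⟨hxy.le, hyt.le⟩ : y ∈ Icc x t)
    rw [slope_def_field, h0, sub_zero] at hy
    exact absurd hy (div_nonneg_of_nonpos h3 (sub_neg.2 hyt).le).not_gt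
  have hmono : MonotoneOn u (openInterval α β ∩ Iic t) := by
    refine monotoneOn_of_deriv_nonneg (hord.inter ordConnected_Iic).convex
      (hu.contDiffOn.continuousOn.mono inter_subset_left)
      (fun x hx => (hu.hasDerivAt (interior_subset hx).1).differentiableAt.differentiableWithinAt)
      fun x hx => ?_
    have hx' := interior_subset hx
    refine deriv_nonneg_of_flux_nonneg (p := p) (hc.d_pos _ (hu.mem_Ioo x hx'.1)) ?_
    rcases (mem_Iic.1 hx'.2).eq_or_lt with rfl | hlt
    · exact hge
    · exact (hpos x hx'.1 hlt).le
  have := neBot_rightOf hu.lt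
  have h1 : (1 : ℝ) ≤ u t := by
    refine le_of_tendsto hu.tendsto_left ?_
    filter_upwards [eventually_rightOf ht.1, eventually_mem_rightOf hu.lt] with x hx hx'
    exact hmono ⟨hx', hx.2.le⟩ ⟨ht, self_mem_Iic⟩ hx.2.le
  exact absurd (hu.mem_Ioo t ht).2 h1.not_gt

theorem deriv_neg (hc : IsMonostable p f g d ρ) (hu : IsTravelingWave p f g d ρ c α β u) {t : ℝ}
    (ht : t ∈ openInterval α β) : deriv u t < 0 :=
  (flux_neg_iff (hc.d_pos _ (hu.mem_Ioo t ht))).1 (hu.flux_neg hc ht)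

theorem strictAntiOn (hc : IsMonostable p f g d ρ) (hu : IsTravelingWave p f g d ρ c α β u) :
    StrictAntiOn u (openInterval α β) :=
  strictAntiOn_of_deriv_neg (ordConnected_openInterval α β).convex hu.contDiffOn.continuousOn
    fun _ hx => hu.deriv_neg hc (interior_subset hx)

theorem surjOn (hu : IsTravelingWave p f g d ρ c α β u) :
    SurjOn u (openInterval α β) (Ioo 0 1) := by
  intro s hs
  have := neBot_rightOf hu.lt
  have := neBot_leftOf hu.lt
  obtain ⟨t₁, h1, h1'⟩ := ((hu.tendsto_left.eventually (lt_mem_nhds hs.2)).and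
    (eventually_mem_rightOf hu.lt)).exists
  obtain ⟨t₂, h2, h2'⟩ := ((hu.tendsto_right.eventually (gt_mem_nhds hs.1)).and
    (eventually_mem_leftOf hu.lt)).exists
  exact (ordConnected_openInterval α β).isPreconnected.intermediate_value h2' h1'
    hu.contDiffOn.continuousOn ⟨h2.le, h1.le⟩

/-- A traveling wave yields a profile, and the time it takes to reach `0` is governed by the
integrability of `(d / z) ^ (1 / (p - 1))`. -/
theorem exists_isProfile (hc : IsMonostable p f g d ρ)
    (hu : IsTravelingWave p f g d ρ c α β u) :
    ∃ z, IsProfile (1 / (p - 1)) (fun s => c * g s - f s)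
      (fun s => ρ s * d s ^ (1 / (p - 1))) z ∧
      (β < ⊤ ↔ IntegrableOn (fun s => d s ^ (1 / (p - 1)) / z s ^ (1 / (p - 1)))
        (Ioc 0 (1 / 2))) := by
  set q := 1 / (p - 1) with hq
  have hanti := hu.strictAntiOn hc
  have hsurj : ∀ s, s ∈ Ioo (0 : ℝ) 1 → ∃ t, t ∈ openInterval α β ∧ u t = s :=
    fun s hs => hu.surjOn hs
  choose! T hT huT using hsurj
  have hTu : ∀ t ∈ openInterval α β, T (u t) = t := fun t ht =>
    hanti.injOn (hT _ (hu.mem_Ioo t ht)) ht (huT _ (hu.mem_Ioo t ht))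
  have hTanti : ∀ a ∈ Ioo (0 : ℝ) 1, ∀ b ∈ Ioo (0 : ℝ) 1, a < b → T b < T a := by
    intro a ha b hb hab
    by_contra! hle
    have := hanti.antitoneOn (hT a ha) (hT b hb) hle
    rw [huT a ha, huT b hb] at this
    exact absurd hab this.not_gt
  have hTderiv : ∀ s ∈ Ioo (0 : ℝ) 1, HasDerivAt T (deriv u (T s))⁻¹ s := fun s hs =>
    hasDerivAt_inverse_of_strictAntiOn (isOpen_openInterval α β) isOpen_Ioo hanti hu.mem_Ioo
      (fun s hs => hT s hs) huT (fun t ht => hu.hasDerivAt ht)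
      (fun t ht => (hu.deriv_neg hc ht).ne) hs
  set z : ℝ → ℝ := fun s => -flux p d u (T s) with hz
  have hzpos : ∀ s ∈ Ioo (0 : ℝ) 1, 0 < z s := fun s hs => neg_pos.2 (hu.flux_neg hc (hT s hs))
  have hderiv : ∀ s ∈ Ioo (0 : ℝ) 1, deriv u (T s) = -(z s ^ q / d s ^ q) := by
    intro s hs
    have h := deriv_eq_of_flux_neg hc.one_lt_p
      (hc.d_pos _ (hu.mem_Ioo _ (hT s hs))) (hu.flux_neg hc (hT s hs))
    rwa [huT s hs] at h
  have hTderiv' : ∀ s ∈ Ioo (0 : ℝ) 1, HasDerivAt T (-(d s ^ q / z s ^ q)) s := by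
    intro s hs
    have h := hTderiv s hs
    rwa [hderiv s hs, inv_neg, inv_div] at h
  have hTleft : Tendsto T (𝓝[<] 1) (rightOf α) := by
    refine tendsto_comap_iff.2 (tendsto_nhdsWithin_iff.2 ⟨tendsto_order.2 ⟨fun b hb => ?_,
      fun b hb => ?_⟩, ?_⟩)
    · filter_upwards [Ioo_mem_nhdsLT zero_lt_one] with s hs using hb.trans (hT s hs).1
    · obtain ⟨t, h1, h2⟩ := EReal.lt_iff_exists_real_btwn.1 (lt_min hb hu.lt)
      have ht : t ∈ openInterval α β := ⟨h1, h2.trans_le (min_le_right _ _)⟩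
      have hut := hu.mem_Ioo t ht
      filter_upwards [Ioo_mem_nhdsLT hut.2] with s hs
      have := hTanti _ hut s ⟨hut.1.trans hs.1, hs.2⟩ hs.1
      rw [hTu t ht] at this
      exact (EReal.coe_lt_coe_iff.2 this).trans (h2.trans_le (min_le_left _ _))
    · filter_upwards [Ioo_mem_nhdsLT zero_lt_one] with s hs using (hT s hs).1
  have hTright : Tendsto T (𝓝[>] 0) (leftOf β) := by
    refine tendsto_comap_iff.2 (tendsto_nhdsWithin_iff.2 ⟨tendsto_order.2 ⟨fun b hb => ?_,
      fun b hb => ?_⟩, ?_⟩)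
    · obtain ⟨t, h1, h2⟩ := EReal.lt_iff_exists_real_btwn.1 (max_lt hb hu.lt)
      have ht : t ∈ openInterval α β := ⟨(le_max_right _ _).trans_lt h1, h2⟩
      have hut := hu.mem_Ioo t ht
      filter_upwards [Ioo_mem_nhdsGT hut.1] with s hs
      have := hTanti s ⟨hs.1, hs.2.trans hut.2⟩ _ hut hs.2
      rw [hTu t ht] at this
      exact ((le_max_left _ _).trans_lt h1).trans (EReal.coe_lt_coe_iff.2 this)
    · filter_upwards [Ioo_mem_nhdsGT zero_lt_one] with s hs using (hT s hs).2.trans hb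
    · filter_upwards [Ioo_mem_nhdsGT zero_lt_one] with s hs using (hT s hs).2
  refine ⟨z, ⟨hzpos, fun s hs => ?_, ?_, ?_⟩, ?_⟩
  -- The chain rule gives `z' = -flux' / u' = (c g - f) + ρ / u'`, and `1 / u' = -(d / z) ^ q`.
  · have h1 := (((hu.hasDerivAt_flux (hT s hs)).comp s (hTderiv s hs)).neg)
    refine h1.congr_deriv ?_
    have h2 := hu.equation _ (hT s hs)
    rw [huT s hs] at h2
    have h3 : deriv (flux p d u) (T s) = -(c * g s - f s) * deriv u (T s) - ρ s := by linarith
    have h4 := (hu.deriv_neg hc (hT s hs)).ne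
    have h5 : (deriv u (T s))⁻¹ = -(d s ^ q / z s ^ q) := by rw [hderiv s hs, inv_neg, inv_div]
    rw [h3, sub_mul, mul_assoc, mul_inv_cancel₀ h4, h5]
    ring
  · simpa using (hu.flux_tendsto_right.comp hTright).neg
  · simpa using (hu.flux_tendsto_left.comp hTleft).neg
  · have hWc : ContinuousOn (fun s => d s ^ q / z s ^ q) (Ioo 0 1) := by
      have hzc : ContinuousOn z (Ioo 0 1) := fun s hs =>
        ((hu.hasDerivAt_flux (hT s hs)).comp s
          (hTderiv s hs)).neg.continuousAt.continuousWithinAt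
      exact (hc.continuousOn_d.rpow_const fun s hs => Or.inl (hc.d_pos s hs).ne').div
        (hzc.rpow_const fun s hs => Or.inl (hzpos s hs).ne')
        fun s hs => (Real.rpow_pos_of_pos (hzpos s hs) q).ne'
    have hhalf : (1 / 2 : ℝ) ∈ Ioo (0 : ℝ) 1 := by norm_num
    have hW0 : ∀ s ∈ Ioo (0 : ℝ) 1, 0 ≤ d s ^ q / z s ^ q := fun s hs =>
      div_nonneg (Real.rpow_nonneg (hc.d_pos s hs).le q) (Real.rpow_nonneg (hzpos s hs).le q)
    -- The integral of `(d / z) ^ q` over `[s, 1/2]` is the time taken from state `1/2` to state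
    -- `s`; it stays bounded as `s → 0` exactly when `β` is finite.
    have hI : ∀ s ∈ Ioc (0 : ℝ) (1 / 2), IntervalIntegrable (fun s => d s ^ q / z s ^ q)
        volume s (1 / 2) ∧ ∫ x in s..(1 / 2), d x ^ q / z x ^ q = T s - T (1 / 2) := by
      intro s hs
      have hsub : Icc s (1 / 2) ⊆ Ioo (0 : ℝ) 1 := fun x hx =>
        ⟨hs.1.trans_le hx.1, hx.2.trans_lt hhalf.2⟩
      have hi := (hWc.mono hsub).intervalIntegrable_of_Icc (μ := volume) hs.2
      refine ⟨hi, ?_⟩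
      have h1 := intervalIntegral.integral_eq_sub_of_hasDerivAt (a := s) (b := 1 / 2)
        (f := fun x => -T x) (f' := fun x => d x ^ q / z x ^ q)
        (fun x hx => by
          rw [uIcc_of_le hs.2] at hx
          exact (hTderiv' x (hsub hx)).neg.congr_deriv (neg_neg _)) hi
      rw [h1]
      ring
    constructor
    · intro hβ
      have hβ' : β = ((β.toReal : ℝ) : EReal) :=
        (EReal.coe_toReal hβ.ne (bot_le.trans_lt hu.lt).ne').symm
      have hb0 : Tendsto (fun n : ℕ => 1 / ((n : ℝ) + 2)) atTop (𝓝 0) := by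
        have h1 : Tendsto (fun n : ℕ => (n : ℝ) + 2) atTop atTop :=
          tendsto_atTop_add_const_right _ _ tendsto_natCast_atTop_atTop
        simp only [one_div]
        exact h1.inv_tendsto_atTop
      have hmem : ∀ n : ℕ, 1 / ((n : ℝ) + 2) ∈ Ioc (0 : ℝ) (1 / 2) := fun n =>
        ⟨by positivity, one_div_le_one_div_of_le (by norm_num) (by
          have : (0 : ℝ) ≤ n := n.cast_nonneg
          linarith)⟩
      refine integrableOn_Ioc_of_intervalIntegral_norm_bounded_left
        (I := β.toReal - T (1 / 2)) (l := atTop) (fun n => ?_) hb0 (Eventually.of_forall fun n => ?_)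
      · exact (intervalIntegrable_iff_integrableOn_Ioc_of_le (hmem n).2).1 (hI _ (hmem n)).1
      · have hn := hmem n
        have h2 : ∫ x in Ioc (1 / ((n : ℝ) + 2)) (1 / 2), ‖d x ^ q / z x ^ q‖ =
            ∫ x in (1 / ((n : ℝ) + 2))..(1 / 2), d x ^ q / z x ^ q := by
          rw [intervalIntegral.integral_of_le hn.2]
          exact setIntegral_congr_fun measurableSet_Ioc fun x hx =>
            Real.norm_of_nonneg (hW0 x ⟨hn.1.trans hx.1, hx.2.trans_lt hhalf.2⟩)
        rw [h2, (hI _ hn).2]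
        have h3 := (hT _ (⟨hn.1, hn.2.trans_lt hhalf.2⟩ : 1 / ((n : ℝ) + 2) ∈ Ioo (0 : ℝ) 1)).2
        rw [hβ', EReal.coe_lt_coe_iff] at h3
        linarith
    · intro hint
      by_contra hβ
      have hβ' : β = ⊤ := not_lt_top_iff.1 hβ
      set R := T (1 / 2) + ∫ x in (0 : ℝ)..(1 / 2), d x ^ q / z x ^ q with hR
      have hbd : ∀ s ∈ Ioc (0 : ℝ) (1 / 2), T s ≤ R := by
        intro s hs
        have h1 : ∫ x in s..(1 / 2), d x ^ q / z x ^ q ≤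
            ∫ x in (0 : ℝ)..(1 / 2), d x ^ q / z x ^ q := by
          refine intervalIntegral.integral_mono_interval hs.1.le hs.2 le_rfl ?_
            ((intervalIntegrable_iff_integrableOn_Ioc_of_le hhalf.1.le).2 hint)
          exact (ae_restrict_iff' measurableSet_Ioc).2 (ae_of_all _ fun x hx =>
            hW0 x ⟨hx.1, hx.2.trans_lt hhalf.2⟩)
        rw [(hI s hs).2] at h1
        linarith
      have hRβ : ((R : ℝ) : EReal) < β := hβ' ▸ EReal.coe_lt_top R
      obtain ⟨s, hs, hs'⟩ := ((hTright.eventually (eventually_leftOf hRβ)).and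
        (Ioo_mem_nhdsGT hhalf.1)).exists
      exact absurd hs.1 (hbd s ⟨hs'.1, hs'.2.le⟩).not_gt

end IsTravelingWave

/-! ### From profiles to waves, and a lower bound on speeds -/

/-- The image of `(0, 1)` under a continuous strictly decreasing function. -/
theorem exists_image_eq_openInterval {T : ℝ → ℝ} (hT : ContinuousOn T (Ioo 0 1))
    (hanti : StrictAntiOn T (Ioo 0 1)) :
    ∃ α β : EReal, α < β ∧ (∀ s ∈ Ioo (0 : ℝ) 1, T s ∈ openInterval α β) ∧
      (∀ t ∈ openInterval α β, ∃ s, s ∈ Ioo (0 : ℝ) 1 ∧ T s = t) := by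
  set S : Set EReal := (fun s => ((T s : ℝ) : EReal)) '' Ioo 0 1 with hS
  have hmem : ∀ s ∈ Ioo (0 : ℝ) 1, ((T s : ℝ) : EReal) ∈ S := fun s hs => mem_image_of_mem _ hs
  have hrange : ∀ s ∈ Ioo (0 : ℝ) 1, T s ∈ openInterval (sInf S) (sSup S) := by
    intro s hs
    have h1 : (s + 1) / 2 ∈ Ioo (0 : ℝ) 1 := ⟨by linarith [hs.1], by linarith [hs.2]⟩
    have h2 : s / 2 ∈ Ioo (0 : ℝ) 1 := ⟨half_pos hs.1, by linarith [hs.1, hs.2]⟩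
    exact ⟨(sInf_le (hmem _ h1)).trans_lt
        (EReal.coe_lt_coe_iff.2 (hanti hs h1 (by linarith [hs.2]))),
      (EReal.coe_lt_coe_iff.2 (hanti h2 hs (half_lt_self hs.1))).trans_le (le_sSup (hmem _ h2))⟩
  refine ⟨sInf S, sSup S, ?_, hrange, fun t ht => ?_⟩
  · have := hrange (1 / 2) (by norm_num)
    exact this.1.trans this.2
  · obtain ⟨_, ⟨s₁, hs₁, rfl⟩, h1⟩ := sInf_lt_iff.1 ht.1
    obtain ⟨_, ⟨s₂, hs₂, rfl⟩, h2⟩ := lt_sSup_iff.1 ht.2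
    obtain ⟨s, hs, rfl⟩ := isPreconnected_Ioo.intermediate_value hs₁ hs₂ hT
      ⟨(EReal.coe_lt_coe_iff.1 h1).le, (EReal.coe_lt_coe_iff.1 h2).le⟩
    exact ⟨s, hs, rfl⟩

/-- A profile is the flux of a traveling wave. -/
theorem IsProfile.exists_isTravelingWave {p c : ℝ} {f g d ρ z : ℝ → ℝ}
    (hc : IsMonostable p f g d ρ)
    (hz : IsProfile (1 / (p - 1)) (fun s => c * g s - f s)
      (fun s => ρ s * d s ^ (1 / (p - 1))) z) :
    ∃ (α β : EReal) (u : ℝ → ℝ), IsTravelingWave p f g d ρ c α β u := by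
  set q := 1 / (p - 1) with hq
  have hp1 : p - 1 ≠ 0 := (sub_pos.2 hc.one_lt_p).ne'
  have hzc : ContinuousOn z (Ioo 0 1) := fun s hs =>
    (hz.hasDerivAt s hs).continuousAt.continuousWithinAt
  have hdq : ∀ s ∈ Ioo (0 : ℝ) 1, 0 < d s ^ q := fun s hs =>
    Real.rpow_pos_of_pos (hc.d_pos s hs) q
  have hzq : ∀ s ∈ Ioo (0 : ℝ) 1, 0 < z s ^ q := fun s hs =>
    Real.rpow_pos_of_pos (hz.pos s hs) q
  have hdqc : ContinuousOn (fun s => d s ^ q) (Ioo 0 1) :=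
    hc.continuousOn_d.rpow_const fun s hs => Or.inl (hc.d_pos s hs).ne'
  have hzqc : ContinuousOn (fun s => z s ^ q) (Ioo 0 1) :=
    hzc.rpow_const fun s hs => Or.inl (hz.pos s hs).ne'
  have hWc : ContinuousOn (fun s => d s ^ q / z s ^ q) (Ioo 0 1) :=
    hdqc.div hzqc fun s hs => (hzq s hs).ne'
  -- The time at which the wave takes the value `s`, normalised to vanish at `1 / 2`; the wave is
  -- its inverse.
  set T : ℝ → ℝ := fun s => -∫ x in (1 / 2 : ℝ)..s, d x ^ q / z x ^ q with hT
  have hhalf : (1 / 2 : ℝ) ∈ Ioo (0 : ℝ) 1 := by norm_num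
  have hTd : ∀ s ∈ Ioo (0 : ℝ) 1, HasDerivAt T (-(d s ^ q / z s ^ q)) s := fun s hs =>
    (intervalIntegral.integral_hasDerivAt_right
      (hWc.mono (ordConnected_Ioo.uIcc_subset hhalf hs)).intervalIntegrable
      (hWc.stronglyMeasurableAtFilter isOpen_Ioo s hs)
      (hWc.continuousAt (isOpen_Ioo.mem_nhds hs))).neg
  have hTneg : ∀ s ∈ Ioo (0 : ℝ) 1, -(d s ^ q / z s ^ q) < 0 := fun s hs =>
    neg_lt_zero.2 (div_pos (hdq s hs) (hzq s hs))
  have hTc : ContinuousOn T (Ioo 0 1) := fun s hs => (hTd s hs).continuousAt.continuousWithinAt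
  have hanti : StrictAntiOn T (Ioo 0 1) := by
    refine strictAntiOn_of_deriv_neg (convex_Ioo 0 1) hTc fun s hs => ?_
    rw [interior_Ioo] at hs
    rw [(hTd s hs).deriv]
    exact hTneg s hs
  obtain ⟨α, β, hαβ, hTmem, hTsurj⟩ := exists_image_eq_openInterval hTc hanti
  choose! u hu hTu using hTsurj
  have huT : ∀ s ∈ Ioo (0 : ℝ) 1, u (T s) = s := fun s hs =>
    hanti.injOn (hu _ (hTmem s hs)) hs (hTu _ (hTmem s hs))
  have hopen := isOpen_openInterval α β
  have hud : ∀ t ∈ openInterval α β, HasDerivAt u (-(z (u t) ^ q / d (u t) ^ q)) t := by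
    intro t ht
    have h := hasDerivAt_inverse_of_strictAntiOn isOpen_Ioo hopen hanti hTmem
      (fun t ht => hu t ht) hTu hTd (fun s hs => (hTneg s hs).ne) ht
    rwa [inv_neg, inv_div] at h
  have huc : ContinuousOn u (openInterval α β) := fun t ht =>
    (hud t ht).continuousAt.continuousWithinAt
  have hflux : ∀ t ∈ openInterval α β, flux p d u t = -z (u t) := by
    intro t ht
    have hs := hu t ht
    have hD := div_pos (hzq _ hs) (hdq _ hs)
    have e : p - 1 = (p - 2) + 1 := by ring
    have h1 : |deriv u t| ^ (p - 2) * deriv u t = -(z (u t) ^ q / d (u t) ^ q) ^ (p - 1) := by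
      rw [(hud t ht).deriv, abs_neg, abs_of_pos hD, e, Real.rpow_add_one hD.ne']
      ring
    rw [flux, mul_assoc, h1, Real.div_rpow (hzq _ hs).le (hdq _ hs).le,
      ← Real.rpow_mul (hz.pos _ hs).le, ← Real.rpow_mul (hc.d_pos _ hs).le, hq,
      one_div_mul_cancel hp1, Real.rpow_one, Real.rpow_one]
    have := (hc.d_pos _ hs).ne'
    field_simp
  have hfluxd : ∀ t ∈ openInterval α β, HasDerivAt (flux p d u)
      (-((c * g (u t) - f (u t) - ρ (u t) * d (u t) ^ q / z (u t) ^ q) *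
        -(z (u t) ^ q / d (u t) ^ q))) t := by
    intro t ht
    have h1 := ((hz.hasDerivAt _ (hu t ht)).comp t (hud t ht)).neg
    refine h1.congr_of_eventuallyEq ?_
    filter_upwards [hopen.mem_nhds ht] with x hx using hflux x hx
  have hmaps : MapsTo u (openInterval α β) (Ioo 0 1) := hu
  have hVc : ContinuousOn (fun t => -(z (u t) ^ q / d (u t) ^ q)) (openInterval α β) :=
    ((hzqc.div hdqc fun s hs => (hdq s hs).ne').neg).comp huc hmaps
  have hright : Tendsto u (leftOf β) (𝓝[>] 0) := by
    refine tendsto_nhdsWithin_iff.2 ⟨tendsto_order.2 ⟨fun b hb => ?_, fun b hb => ?_⟩, ?_⟩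
    · filter_upwards [eventually_mem_leftOf hαβ] with t ht using hb.trans (hu t ht).1
    · have hs : min b 1 / 2 ∈ Ioo (0 : ℝ) 1 :=
        ⟨half_pos (lt_min hb one_pos), by linarith [min_le_right b 1]⟩
      filter_upwards [eventually_mem_leftOf hαβ, eventually_leftOf (hTmem _ hs).2] with t ht ht'
      by_contra! hle
      have hlt : min b 1 / 2 < u t :=
        (half_lt_self (lt_min hb one_pos)).trans_le ((min_le_left _ _).trans hle)
      have := hanti hs (hu t ht) hlt
      rw [hTu t ht] at this
      exact absurd ht'.1 this.not_gt
    · filter_upwards [eventually_mem_leftOf hαβ] with t ht using (hu t ht).1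
  have hleft : Tendsto u (rightOf α) (𝓝[<] 1) := by
    refine tendsto_nhdsWithin_iff.2 ⟨tendsto_order.2 ⟨fun b hb => ?_, fun b hb => ?_⟩, ?_⟩
    · have hs : (max b 0 + 1) / 2 ∈ Ioo (0 : ℝ) 1 :=
        ⟨by linarith [le_max_right b 0], by linarith [max_lt hb one_pos]⟩
      filter_upwards [eventually_mem_rightOf hαβ, eventually_rightOf (hTmem _ hs).1] with t ht ht'
      by_contra! hle
      have hlt : u t < (max b 0 + 1) / 2 := by
        linarith [le_max_left b 0, max_lt hb one_pos]
      have := hanti (hu t ht) hs hlt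
      rw [hTu t ht] at this
      exact absurd ht'.2 this.not_gt
    · filter_upwards [eventually_mem_rightOf hαβ] with t ht using (hu t ht).2.trans hb
    · filter_upwards [eventually_mem_rightOf hαβ] with t ht using (hu t ht).2
  refine ⟨α, β, u, hαβ, contDiffOn_one_of_hasDerivAt hopen hud hVc, hu,
    contDiffOn_one_of_hasDerivAt hopen hfluxd ?_, fun t ht => ?_,
    hleft.mono_right nhdsWithin_le_nhds, hright.mono_right nhdsWithin_le_nhds, ?_, ?_⟩
  · have hR : ContinuousOn (fun s => c * g s - f s - ρ s * d s ^ q / z s ^ q) (Ioo 0 1) :=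
      ((hc.continuousOn_drift c).mono Ioo_subset_Icc_self).sub
        (hc.continuousOn_reaction_mul.div hzqc fun s hs => (hzq s hs).ne')
    exact ((hR.comp huc hmaps).mul hVc).neg
  · rw [(hfluxd t ht).deriv, (hud t ht).deriv]
    have h1 := (hzq _ (hu t ht)).ne'
    have h2 := (hdq _ (hu t ht)).ne'
    field_simp
    ring
  · have h1 := (hz.tendsto_one.comp hleft).neg
    rw [neg_zero] at h1
    refine h1.congr' ?_
    filter_upwards [eventually_mem_rightOf hαβ] with t ht using (hflux t ht).symm
  · have h1 := (hz.tendsto_zero.comp hright).neg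
    rw [neg_zero] at h1
    refine h1.congr' ?_
    filter_upwards [eventually_mem_leftOf hαβ] with t ht using (hflux t ht).symm

/-- The admissible speeds are bounded below, by `∫ f / ∫ g`. -/
theorem bddBelow_admissibleSpeeds {p : ℝ} {f g d ρ : ℝ → ℝ} (hc : IsMonostable p f g d ρ) :
    BddBelow (admissibleSpeeds p f g d ρ) := by
  have hG := hc.integral_g_pos 1 (by simp)
  refine ⟨(∫ s in (0 : ℝ)..1, f s) / ∫ s in (0 : ℝ)..1, g s, ?_⟩
  rintro c ⟨α, β, u, hu⟩
  obtain ⟨z, hz, -⟩ := hu.exists_isProfile hc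
  rw [div_le_iff₀ hG]
  have hcont := hc.continuousOn_drift c
  have hii := hcont.intervalIntegrable_of_Icc (μ := volume) zero_le_one
  have hP : ContinuousOn (fun s => ∫ x in (0 : ℝ)..s, (c * g x - f x)) (Icc 0 1) := by
    have := intervalIntegral.continuousOn_primitive_interval (a := 0) (b := 1) (μ := volume)
      (f := fun x => c * g x - f x) (by
        rw [uIcc_of_le zero_le_one]
        exact hcont.integrableOn_Icc)
    rwa [uIcc_of_le zero_le_one] at this
  -- Removing the drift leaves a nonincreasing function that runs from `0` to minus the integral of
  -- `c g - f`, so this integral is nonnegative.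
  set y : ℝ → ℝ := fun s => z s - ∫ x in (0 : ℝ)..s, (c * g x - f x) with hy
  have hyd : ∀ s ∈ Ioo (0 : ℝ) 1,
      HasDerivAt y (-(ρ s * d s ^ (1 / (p - 1)) / z s ^ (1 / (p - 1)))) s := by
    intro s hs
    have h1 := intervalIntegral.integral_hasDerivAt_right (a := 0) (b := s)
      ((hcont.mono (Icc_subset_Icc_right hs.2.le)).intervalIntegrable_of_Icc (μ := volume) hs.1.le)
      ((hcont.mono Ioo_subset_Icc_self).stronglyMeasurableAtFilter isOpen_Ioo s hs)
      (hcont.continuousAt (Icc_mem_nhds hs.1 hs.2))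
    refine ((hz.hasDerivAt s hs).sub h1).congr_deriv ?_
    ring
  have hanti : AntitoneOn y (Ioo 0 1) := by
    refine antitoneOn_of_deriv_nonpos (convex_Ioo 0 1)
      (fun s hs => (hyd s hs).continuousAt.continuousWithinAt)
      (fun s hs => (hyd s (interior_subset hs)).differentiableAt.differentiableWithinAt)
      fun s hs => ?_
    have hs' := interior_subset hs
    rw [(hyd s hs').deriv]
    exact neg_nonpos.2 (div_nonneg (hc.reaction_mul_pos hs').le
      (Real.rpow_nonneg (hz.pos s hs').le _))
  have h0 : Tendsto y (𝓝[>] 0) (𝓝 0) := by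
    have h1 := (hP 0 (by simp)).tendsto.mono_left
      (nhdsWithin_le_iff.2 (mem_of_superset (Ioo_mem_nhdsGT zero_lt_one) Ioo_subset_Icc_self))
    simpa using hz.tendsto_zero.sub h1
  have h1 : Tendsto y (𝓝[<] 1) (𝓝 (0 - ∫ x in (0 : ℝ)..1, (c * g x - f x))) :=
    hz.tendsto_one.sub ((hP 1 (by simp)).tendsto.mono_left
      (nhdsWithin_le_iff.2 (mem_of_superset (Ioo_mem_nhdsLT zero_lt_one) Ioo_subset_Icc_self)))
  have hle : ∀ s ∈ Ioo (0 : ℝ) 1, y s ≤ 0 := by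
    intro s hs
    refine ge_of_tendsto h0 ?_
    filter_upwards [Ioo_mem_nhdsGT hs.1] with x hx
    exact hanti ⟨hx.1, hx.2.trans hs.2⟩ hs hx.2.le
  have h2 : 0 - ∫ x in (0 : ℝ)..1, (c * g x - f x) ≤ 0 := by
    refine le_of_tendsto h1 ?_
    filter_upwards [Ioo_mem_nhdsLT zero_lt_one] with s hs using hle s hs
  have hgi := hc.continuousOn_g.intervalIntegrable_of_Icc (μ := volume) zero_le_one
  have hfi := hc.continuousOn_f.intervalIntegrable_of_Icc (μ := volume) zero_le_one
  rw [intervalIntegral.integral_sub (hgi.const_mul c) hfi,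
    intervalIntegral.integral_const_mul] at h2
  linarith

/-! ### Linear bounds and barriers at zero -/

/-- The singular term only lowers the slope, so `z' ≤ H`, and `z` starts from `0`. The constant `H +
1` is used because `H` may vanish. -/
theorem IsProfile.exists_le_mul {q : ℝ} {h k z : ℝ → ℝ} (hz : IsProfile q h k z)
    (hh : ContinuousOn h (Icc 0 1)) (hk : ∀ s ∈ Ioo (0 : ℝ) 1, 0 < k s) :
    ∃ K : ℝ, 0 < K ∧ ∀ s ∈ Ioo (0 : ℝ) 1, z s ≤ K * s := by
  obtain ⟨H, hH⟩ := isCompact_Icc.exists_bound_of_continuousOn hh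
  have hH0 : 0 ≤ H := (norm_nonneg _).trans (hH 0 (by simp))
  have hd : ∀ s ∈ Ioo (0 : ℝ) 1, HasDerivAt (fun x => z x - H * x)
      (h s - k s / z s ^ q - H) s := fun s hs => by
    exact ((hz.hasDerivAt s hs).sub ((hasDerivAt_id s).const_mul H)).congr_deriv (by rw [mul_one])
  have hanti : AntitoneOn (fun x => z x - H * x) (Ioo 0 1) := by
    refine antitoneOn_of_deriv_nonpos (convex_Ioo 0 1)
      (fun s hs => (hd s hs).continuousAt.continuousWithinAt)
      (fun s hs => (hd s (interior_subset hs)).differentiableAt.differentiableWithinAt)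
      fun s hs => ?_
    have hs' := interior_subset hs
    rw [(hd s hs').deriv]
    have h1 := (abs_le.1 (hH s (Ioo_subset_Icc_self hs'))).2
    have h2 := div_nonneg (hk s hs').le (Real.rpow_nonneg (hz.pos s hs').le q)
    linarith
  have h0 : Tendsto (fun x => z x - H * x) (𝓝[>] 0) (𝓝 0) := by
    have h1 : Tendsto (fun x : ℝ => H * x) (𝓝[>] 0) (𝓝 (H * 0)) :=
      (continuous_const.mul continuous_id).continuousAt.tendsto.mono_left nhdsWithin_le_nhds
    simpa using hz.tendsto_zero.sub h1
  refine ⟨H + 1, by linarith, fun s hs => ?_⟩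
  have hle : z s - H * s ≤ 0 := by
    refine ge_of_tendsto h0 ?_
    filter_upwards [Ioo_mem_nhdsGT hs.1] with x hx
    exact hanti ⟨hx.1, hx.2.trans hs.2⟩ hs hx.2.le
  linarith [hs.1]

/-- A barrier below a profile near `0`. -/
theorem IsProfile.exists_barrier_le {q H δ : ℝ} {h k z w w' : ℝ → ℝ} (hq : 0 < q)
    (hz : IsProfile q h k z) (hk : ∀ s ∈ Ioo (0 : ℝ) 1, 0 < k s) (hδ : 0 < δ) (hδ1 : δ ≤ 1)
    (hH : ∀ s ∈ Ioo (0 : ℝ) δ, h s ≤ H)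
    (hw : ∀ s ∈ Ioo (0 : ℝ) δ, HasDerivAt w (w' s) s) (hw' : ∀ s ∈ Ioo (0 : ℝ) δ, -1 ≤ w' s)
    (hkw : ∀ s ∈ Ioo (0 : ℝ) δ, H + 1 ≤ k s / w s ^ q) :
    ∃ s₁ ∈ Ioo (0 : ℝ) 1, ∀ s ∈ Ioo (0 : ℝ) s₁, w s ≤ z s := by
  have hsub : Ioo 0 δ ⊆ Ioo (0 : ℝ) 1 := Ioo_subset_Ioo_right hδ1
  -- Below the barrier `z` falls at least as fast as `w` can.
  have hz' : ∀ s ∈ Ioo (0 : ℝ) δ, z s < w s → h s - k s / z s ^ q ≤ -1 := by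
    intro s hs hlt
    have h1 := div_rpow_antitone hq (hk s (hsub hs)).le (hz.pos s (hsub hs)) hlt.le
    linarith [hH s hs, hkw s hs]
  -- If `z` reaches `w` at some `s₁`, it cannot be below `w` earlier, as the gap `w - z` would not
  -- close. If it never does, `z` is nonincreasing on `(0, δ)` with limit `0` at `0`, against
  -- positivity.
  by_cases hex : ∃ s₁ ∈ Ioo (0 : ℝ) δ, w s₁ ≤ z s₁
  · obtain ⟨s₁, hs₁, hle₁⟩ := hex
    refine ⟨s₁, hsub hs₁, fun s hs => ?_⟩
    by_contra! hlt
    have hIcc : Icc s s₁ ⊆ Ioo 0 δ := fun x hx => ⟨hs.1.trans_le hx.1, hx.2.trans_lt hs₁.2⟩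
    have hd : ∀ x ∈ Icc s s₁, HasDerivAt (fun x => w x - z x)
        (w' x - (h x - k x / z x ^ q)) x := fun x hx =>
      (hw x (hIcc hx)).sub (hz.hasDerivAt x (hsub (hIcc hx)))
    have hle := le_of_hasDerivWithinAt_nonneg_of_pos (φ := fun x => w x - z x)
      (φ' := fun x => w' x - (h x - k x / z x ^ q)) hs.2.le
      (fun x hx => (hd x hx).continuousAt.continuousWithinAt)
      (fun x hx => (hd x (Ico_subset_Icc_self hx)).hasDerivWithinAt)
      (fun x hx hpos => by
        have hx' := hIcc (Ico_subset_Icc_self hx)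
        linarith [hw' x hx', hz' x hx' (sub_pos.1 hpos)]) (sub_pos.2 hlt)
    linarith
  · push Not at hex
    exfalso
    have hanti : AntitoneOn z (Ioo 0 δ) := by
      refine antitoneOn_of_deriv_nonpos (convex_Ioo 0 δ)
        (fun s hs => (hz.hasDerivAt s (hsub hs)).continuousAt.continuousWithinAt)
        (fun s hs => (hz.hasDerivAt s
          (hsub (interior_subset hs))).differentiableAt.differentiableWithinAt) fun s hs => ?_
      have hs' := interior_subset hs
      rw [(hz.hasDerivAt s (hsub hs')).deriv]
      linarith [hz' s hs' (hex s hs')]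
    have hmid : δ / 2 ∈ Ioo 0 δ := ⟨half_pos hδ, half_lt_self hδ⟩
    have hle : z (δ / 2) ≤ 0 := by
      refine ge_of_tendsto hz.tendsto_zero ?_
      filter_upwards [Ioo_mem_nhdsGT hmid.1] with x hx
      exact hanti ⟨hx.1, hx.2.trans hmid.2⟩ hmid hx.2.le
    exact absurd (hz.pos _ (hsub hmid)) hle.not_gt

/-- Away from `0` the function is continuous on a compact interval, so only the comparison near `0`
matters. -/
theorem integrableOn_Ioc_of_le_near_zero {A B : ℝ → ℝ} {δ C : ℝ}
    (hA : ContinuousOn A (Ioo 0 1)) (hA0 : ∀ s ∈ Ioo (0 : ℝ) 1, 0 ≤ A s) (hδ : 0 < δ)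
    (hAB : ∀ s ∈ Ioo (0 : ℝ) 1, s < δ → A s ≤ C * B s) (hB : IntegrableOn B (Ioc 0 (1 / 2))) :
    IntegrableOn A (Ioc 0 (1 / 2)) := by
  set η := min (δ / 2) (1 / 2) with hη
  have hη0 : 0 < η := lt_min (half_pos hδ) (by norm_num)
  have hη2 : η ≤ 1 / 2 := min_le_right _ _
  have hηδ : η < δ := (min_le_left _ _).trans_lt (half_lt_self hδ)
  have hsub : Ioc 0 η ⊆ Ioo (0 : ℝ) 1 := fun x hx => ⟨hx.1, by linarith [hx.2]⟩
  have h1 : IntegrableOn A (Ioc 0 η) := by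
    refine Integrable.mono' ((hB.mono_set (Ioc_subset_Ioc_right hη2)).const_mul C)
      ((hA.mono hsub).aestronglyMeasurable measurableSet_Ioc) ?_
    refine (ae_restrict_iff' measurableSet_Ioc).2 (ae_of_all _ fun x hx => ?_)
    rw [Real.norm_of_nonneg (hA0 x (hsub hx))]
    exact hAB x (hsub hx) (hx.2.trans_lt hηδ)
  have h2 : IntegrableOn A (Icc η (1 / 2)) :=
    (hA.mono fun x hx => ⟨hη0.trans_le hx.1, by linarith [hx.2]⟩).integrableOn_Icc
  refine (h1.union h2).mono_set fun x hx => ?_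
  rcases le_total x η with hxη | hxη
  · exact Or.inl ⟨hx.1, hxη⟩
  · exact Or.inr ⟨hxη, hx.2⟩

theorem reaction_mul_div_mul_rpow {q a b κ s : ℝ} (hκ : 0 < κ) (hs : 0 < s) :
    a * b ^ q / (κ * s) ^ q = a * (b ^ q / s ^ q) / κ ^ q := by
  rw [Real.mul_rpow hκ.le hs.le]
  have := (Real.rpow_pos_of_pos hκ q).ne'
  have := (Real.rpow_pos_of_pos hs q).ne'
  field_simp

theorem exists_Ioo_of_eventually {P : ℝ → Prop} (h : ∀ᶠ s in 𝓝[>] (0 : ℝ), P s) :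
    ∃ δ : ℝ, 0 < δ ∧ δ ≤ 1 ∧ ∀ s ∈ Ioo 0 δ, P s := by
  obtain ⟨δ, hδ, hsub⟩ := (mem_nhdsGT_iff_exists_Ioo_subset' (zero_lt_one' ℝ)).1 h
  exact ⟨min δ 1, lt_min hδ one_pos, min_le_right _ _, fun s hs =>
    hsub ⟨hs.1, hs.2.trans_le (min_le_left _ _)⟩⟩

/-- If a profile of speed `c` dips below a line of small slope near `0`, then some smaller speed is
also admissible. -/
theorem IsProfile.exists_mul_le_of_forall_admissible {p c : ℝ} {f g d ρ z : ℝ → ℝ}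
    (hc : IsMonostable p f g d ρ)
    (hz : IsProfile (1 / (p - 1)) (fun s => c * g s - f s)
      (fun s => ρ s * d s ^ (1 / (p - 1))) z)
    (hlim : Tendsto (fun s : ℝ => ρ s * (d s ^ (1 / (p - 1)) / s ^ (1 / (p - 1))))
      (𝓝[>] 0) (𝓝 0))
    (hpos : f 0 < c * g 0) (hmin : ∀ c' ∈ admissibleSpeeds p f g d ρ, c ≤ c') :
    ∃ κ δ : ℝ, 0 < κ ∧ 0 < δ ∧ ∀ s ∈ Ioo (0 : ℝ) 1, s < δ → κ * s ≤ z s := by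
  set q := 1 / (p - 1) with hq_def
  have hq : 0 < q := hc.inv_pos
  -- Along the line of slope `κ` the right-hand side tends to `2 κ`, which leaves room for a smaller
  -- speed.
  set κ := (c * g 0 - f 0) / 2 with hκ_def
  have hκ : 0 < κ := half_pos (sub_pos.2 hpos)
  have hlim' : Tendsto (fun s => c * g s - f s - ρ s * d s ^ q / (κ * s) ^ q) (𝓝[>] 0)
      (𝓝 (2 * κ)) := by
    have h1 : Tendsto (fun s => c * g s - f s) (𝓝[>] 0) (𝓝 (c * g 0 - f 0)) :=
      ((hc.continuousOn_drift c) 0 (by simp)).tendsto.mono_left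
        (nhdsWithin_le_iff.2 (mem_of_superset (Ioo_mem_nhdsGT zero_lt_one) Ioo_subset_Icc_self))
    have h2 := h1.sub (hlim.div_const (κ ^ q))
    rw [zero_div, sub_zero] at h2
    have e : c * g 0 - f 0 = 2 * κ := by rw [hκ_def]; ring
    rw [e] at h2
    refine h2.congr' ?_
    filter_upwards [self_mem_nhdsWithin] with s hs
    rw [reaction_mul_div_mul_rpow hκ hs]
  obtain ⟨δ, hδ, hδ1, hδs⟩ := exists_Ioo_of_eventually
    (hlim'.eventually (le_mem_nhds (show 3 / 2 * κ < 2 * κ by linarith)))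
  refine ⟨κ, δ, hκ, hδ, fun s₁ hs₁ hs₁δ => ?_⟩
  by_contra! hlt
  obtain ⟨Γ, hΓ⟩ := isCompact_Icc.exists_bound_of_continuousOn hc.continuousOn_g
  have hΓ0 : 0 ≤ Γ := (norm_nonneg _).trans (hΓ 0 (by simp))
  set η := κ * s₁ - z s₁ with hη_def
  have hη : 0 < η := sub_pos.2 hlt
  -- The loss `e |g| ≤ κ / 2` keeps the line a subsolution at speed `c - e`; the bound `e Γ ≤ η`
  -- keeps the right-hand piece above `z`.
  set e := min (κ / 2) η / (Γ + 1) with he_def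
  have hm : 0 < min (κ / 2) η := lt_min (half_pos hκ) hη
  have he : 0 < e := div_pos hm (by linarith)
  have heΓ : e * Γ ≤ min (κ / 2) η := by
    rw [he_def, div_mul_eq_mul_div, div_le_iff₀ (by linarith)]
    exact mul_le_mul_of_nonneg_left (by linarith) hm.le
  have hgI : ∀ s ∈ Ioo (0 : ℝ) 1, IntervalIntegrable g volume s₁ s := fun s hs =>
    (hc.continuousOn_g.mono
      ((ordConnected_Ioo.uIcc_subset hs₁ hs).trans Ioo_subset_Icc_self)).intervalIntegrable
  set Y : ℝ → ℝ := fun s => z s - e * ∫ x in s₁..s, g x with hY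
  have hYd : ∀ s ∈ Ioo (0 : ℝ) 1, HasDerivAt Y
      (c * g s - f s - ρ s * d s ^ q / z s ^ q - e * g s) s := by
    intro s hs
    have h1 := intervalIntegral.integral_hasDerivAt_right (hgI s hs)
      ((hc.continuousOn_g.mono Ioo_subset_Icc_self).stronglyMeasurableAtFilter isOpen_Ioo s hs)
      (hc.continuousOn_g.continuousAt (Icc_mem_nhds hs.1 hs.2))
    exact (hz.hasDerivAt s hs).sub (h1.const_mul e)
  have hYs₁ : Y s₁ = z s₁ := by simp [hY]
  -- The line up to `s₁`, then `z - e ∫ g` raised by `η` to match it. Since this second piece lies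
  -- above `z`, replacing `z` by `w` in the singular term only helps. At the corner only the right
  -- derivative is needed.
  set w : ℝ → ℝ := fun s => κ * min s s₁ + (Y (max s s₁) - Y s₁) with hw
  have hw_left : ∀ s, s ≤ s₁ → w s = κ * s := fun s hs => by
    simp [hw, min_eq_left hs, max_eq_right hs]
  have hw_right : ∀ s, s₁ ≤ s → w s = Y s + η := fun s hs => by
    simp only [hw, min_eq_right hs, max_eq_left hs, hYs₁, hη_def]
    ring
  have hmax : ∀ s ∈ Ioo (0 : ℝ) 1, max s s₁ ∈ Ioo (0 : ℝ) 1 := fun s hs =>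
    ⟨lt_max_of_lt_left hs.1, max_lt hs.2 hs₁.2⟩
  have hwz : ∀ s ∈ Ioo (0 : ℝ) 1, s₁ ≤ s → z s ≤ w s := by
    intro s hs hle
    have h1 : ‖∫ x in s₁..s, g x‖ ≤ Γ * |s - s₁| := by
      refine intervalIntegral.norm_integral_le_of_norm_le_const fun x hx => hΓ x ?_
      rw [uIoc_of_le hle] at hx
      exact ⟨hs₁.1.le.trans hx.1.le, hx.2.trans hs.2.le⟩
    have h2 : Γ * |s - s₁| ≤ Γ := by
      refine mul_le_of_le_one_right hΓ0 ?_
      rw [abs_of_nonneg (sub_nonneg.2 hle)]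
      linarith [hs.2, hs₁.1]
    have h3 := (le_abs_self _).trans (h1.trans h2)
    have h4 := mul_le_mul_of_nonneg_left h3 he.le
    have h5 := heΓ.trans (min_le_right _ _)
    rw [hw_right s hle]
    simp only [hY]
    linarith
  obtain ⟨z', hz'⟩ := exists_isProfile (q := q) (h := fun s => (c - e) * g s - f s)
    (k := fun s => ρ s * d s ^ q) (w := w)
    (w' := fun s => if s < s₁ then κ else c * g s - f s - ρ s * d s ^ q / z s ^ q - e * g s)
    hq (hc.continuousOn_drift (c - e)) hc.continuousOn_reaction_mul
    (fun s hs => hc.reaction_mul_pos hs) hc.integrableOn_reaction_mul_d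
    (by
      have hYc : ContinuousOn Y (Ioo 0 1) := fun s hs =>
        (hYd s hs).continuousAt.continuousWithinAt
      exact (by fun_prop : ContinuousOn (fun s => κ * min s s₁) (Ioo 0 1)).add
        ((hYc.comp (by fun_prop) hmax).sub continuousOn_const))
    (fun s hs => by
      rcases le_total s s₁ with hle | hle
      · rw [hw_left s hle]
        exact mul_pos hκ hs.1
      · exact (hz.pos s hs).trans_le (hwz s hs hle))
    (fun s hs => by
      split_ifs with hlt'
      · have h1 : HasDerivAt (fun x => κ * x) κ s := by
          simpa using (hasDerivAt_id s).const_mul κ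
        refine (h1.congr_of_eventuallyEq ?_).hasDerivWithinAt
        filter_upwards [Iio_mem_nhds hlt'] with x hx using hw_left x (le_of_lt hx)
      · push Not at hlt'
        exact ((hYd s hs).add_const η).hasDerivWithinAt.congr
          (fun x hx => hw_right x (hlt'.trans hx)) (hw_right s hlt'))
    (fun s hs => by
      split_ifs with hlt'
      · have h1 : 3 / 2 * κ ≤ c * g s - f s - ρ s * d s ^ q / (κ * s) ^ q :=
          hδs s ⟨hs.1, hlt'.trans hs₁δ⟩
        have h2 := (le_abs_self _).trans (hΓ s (Ioo_subset_Icc_self hs))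
        have h3 := mul_le_mul_of_nonneg_left h2 he.le
        have h4 := heΓ.trans (min_le_left _ _)
        rw [hw_left s hlt'.le]
        linarith
      · push Not at hlt'
        have := div_rpow_antitone hq (hc.reaction_mul_pos hs).le (hz.pos s hs) (hwz s hs hlt')
        linarith)
    (by
      have h1 : Tendsto (fun s : ℝ => κ * s) (𝓝[>] 0) (𝓝 (κ * 0)) :=
        (continuous_const.mul continuous_id).continuousAt.tendsto.mono_left nhdsWithin_le_nhds
      rw [mul_zero] at h1
      refine h1.congr' ?_
      filter_upwards [Ioo_mem_nhdsGT hs₁.1] with s hs using (hw_left s hs.2.le).symm)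
  have := hmin _ (hz'.exists_isTravelingWave hc)
  linarith

theorem IsProfile.continuousOn_div {p q : ℝ} {f g d ρ h k z : ℝ → ℝ}
    (hc : IsMonostable p f g d ρ) (hz : IsProfile q h k z) :
    ContinuousOn (fun s => d s ^ q / z s ^ q) (Ioo 0 1) :=
  (hc.continuousOn_d.rpow_const fun s hs => Or.inl (hc.d_pos s hs).ne').div
    (ContinuousOn.rpow_const
      (fun s hs => (hz.hasDerivAt s hs).continuousAt.continuousWithinAt)
      fun s hs => Or.inl (hz.pos s hs).ne')
    fun s hs => (Real.rpow_pos_of_pos (hz.pos s hs) q).ne'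

end ReactionDiffusion

/-! ### The three cases -/

theorem theorem5p2 (p : ℝ) (f g d ρ : ℝ → ℝ)
    (hcoeff : ReactionDiffusion.IsMonostable p f g d ρ)
    (ℓ₀ : ℝ)
    (hℓ₀ : Tendsto (fun u : ℝ => ρ u * (d u ^ (1 / (p - 1)) / u ^ (1 / (p - 1))))
      (𝓝[>] 0) (𝓝 ℓ₀))
    (α β : EReal) (u : ℝ → ℝ)
    (hu : ReactionDiffusion.IsTravelingWave p f g d ρ
      (ReactionDiffusion.criticalSpeed p f g d ρ) α β u) :
    (0 < ℓ₀ →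
      (β < ⊤ ↔ IntegrableOn (fun s : ℝ => 1 / ρ s) (Ioc 0 (1 / 2)))) ∧
    (ℓ₀ = 0 → f 0 < ReactionDiffusion.criticalSpeed p f g d ρ * g 0 →
      (β < ⊤ ↔ IntegrableOn (fun s : ℝ => (d s / s) ^ (1 / (p - 1))) (Ioc 0 (1 / 2)))) ∧
    (ℓ₀ = 0 → ReactionDiffusion.criticalSpeed p f g d ρ * g 0 - f 0 = 0 →
      ReactionDiffusion.ComparableToC1 p d ρ →
      IntegrableOn (fun s : ℝ => 1 / ρ s) (Ioc 0 (1 / 2)) → β < ⊤) := by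
  obtain ⟨z, hz, hβ⟩ := hu.exists_isProfile hcoeff
  rw [hβ]
  -- The lower bound on speeds is essential: the real `sInf` of a set unbounded below is the default
  -- value `0`.
  have hmin : ∀ c ∈ ReactionDiffusion.admissibleSpeeds p f g d ρ, ReactionDiffusion.criticalSpeed p f g d ρ ≤ c :=
    fun c hc => csInf_le (ReactionDiffusion.bddBelow_admissibleSpeeds hcoeff) hc
  generalize ReactionDiffusion.criticalSpeed p f g d ρ = c at hz hmin ⊢
  have hlow := hz.exists_mul_le_of_forall_admissible hcoeff
  set q := 1 / (p - 1) with hq_def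
  have hq : 0 < q := hcoeff.inv_pos
  have hdrift := hcoeff.continuousOn_drift c
  have hkpos : ∀ s ∈ Ioo (0 : ℝ) 1, 0 < ρ s * d s ^ q := fun s hs => hcoeff.reaction_mul_pos hs
  obtain ⟨K, hK, hzK⟩ := hz.exists_le_mul hdrift hkpos
  obtain ⟨H, hH⟩ := isCompact_Icc.exists_bound_of_continuousOn hdrift
  have hH0 : 0 ≤ H := (norm_nonneg _).trans (hH 0 (by simp))
  have hHle : ∀ s ∈ Ioo (0 : ℝ) 1, c * g s - f s ≤ H := fun s hs =>
    (le_abs_self _).trans (hH s (Ioo_subset_Icc_self hs))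
  have hWc := hz.continuousOn_div hcoeff
  have hdq : ∀ s ∈ Ioo (0 : ℝ) 1, 0 < d s ^ q := fun s hs =>
    Real.rpow_pos_of_pos (hcoeff.d_pos s hs) q
  have hzq : ∀ s ∈ Ioo (0 : ℝ) 1, 0 < z s ^ q := fun s hs =>
    Real.rpow_pos_of_pos (hz.pos s hs) q
  have hW0 : ∀ s ∈ Ioo (0 : ℝ) 1, 0 ≤ d s ^ q / z s ^ q := fun s hs =>
    (div_pos (hdq s hs) (hzq s hs)).le
  have hρc : ContinuousOn (fun s => 1 / ρ s) (Ioo 0 1) := continuousOn_const.div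
    (hcoeff.continuousOn_reaction.mono Ioo_subset_Icc_self)
    fun s hs => (hcoeff.reaction_pos s hs).ne'
  have hρ0 : ∀ s ∈ Ioo (0 : ℝ) 1, 0 ≤ 1 / ρ s := fun s hs =>
    (one_div_pos.2 (hcoeff.reaction_pos s hs)).le
  have hKq : 0 < K ^ q := Real.rpow_pos_of_pos hK q
  have hlowK : ∀ s ∈ Ioo (0 : ℝ) 1, d s ^ q / s ^ q ≤ K ^ q * (d s ^ q / z s ^ q) := by
    intro s hs
    have h1 := ReactionDiffusion.div_rpow_antitone hq (hdq s hs).le (hz.pos s hs) (hzK s hs)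
    rw [Real.mul_rpow hK.le hs.1.le, div_le_iff₀ (mul_pos hKq (Real.rpow_pos_of_pos hs.1 q))] at h1
    rw [div_le_iff₀ (Real.rpow_pos_of_pos hs.1 q)]
    linarith
  have hupκ : ∀ κ : ℝ, 0 < κ → ∀ s ∈ Ioo (0 : ℝ) 1, κ * s ≤ z s →
      d s ^ q / z s ^ q ≤ (κ ^ q)⁻¹ * (d s ^ q / s ^ q) := by
    intro κ hκ s hs hle
    refine (ReactionDiffusion.div_rpow_antitone hq (hdq s hs).le (mul_pos hκ hs.1) hle).trans_eq ?_
    rw [Real.mul_rpow hκ.le hs.1.le]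
    have := (Real.rpow_pos_of_pos hκ q).ne'
    have := (Real.rpow_pos_of_pos hs.1 q).ne'
    field_simp
  refine ⟨fun hℓ => ?_, fun hℓ hpos => ?_, fun _ _ hξ hint => ?_⟩
  · obtain ⟨δ, hδ, hδ1, hδs⟩ := ReactionDiffusion.exists_Ioo_of_eventually
      ((hℓ₀.eventually (le_mem_nhds (half_lt_self hℓ))).and
        (hℓ₀.eventually (ge_mem_nhds (show ℓ₀ < 2 * ℓ₀ by linarith))))
    -- Near `0` this gives `k / (κ s) ^ q ≥ (ℓ₀ / 2) / κ ^ q = H + 1`, as the barrier lemma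
    -- requires.
    set κ := (ℓ₀ / 2 / (H + 1)) ^ (1 / q) with hκ_def
    have hκ : 0 < κ := by positivity
    have hκq : κ ^ q = ℓ₀ / 2 / (H + 1) := by
      rw [hκ_def, ← Real.rpow_mul (by positivity), one_div_mul_cancel hq.ne', Real.rpow_one]
    obtain ⟨s₁, hs₁, hκz⟩ := hz.exists_barrier_le (H := H) (w := fun s => κ * s)
      (w' := fun _ => κ) hq hkpos hδ hδ1
      (fun s hs => hHle s ⟨hs.1, hs.2.trans_le hδ1⟩)
      (fun s _ => by simpa using (hasDerivAt_id s).const_mul κ) (fun _ _ => by linarith)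
      (fun s hs => by
        rw [ReactionDiffusion.reaction_mul_div_mul_rpow hκ hs.1, hκq, le_div_iff₀ (by positivity)]
        refine le_trans (le_of_eq ?_) (hδs s hs).1
        field_simp)
    constructor
    · refine ReactionDiffusion.integrableOn_Ioc_of_le_near_zero (C := K ^ q * (2 / ℓ₀)) hρc hρ0 hδ fun s hs hsδ => ?_
      have h1 := (hδs s ⟨hs.1, hsδ⟩).1
      have h2 := mul_le_mul_of_nonneg_left (hlowK s hs) (hcoeff.reaction_pos s hs).le
      have h3 : ℓ₀ / 2 ≤ ρ s * (K ^ q * (d s ^ q / z s ^ q)) := h1.trans h2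
      rw [div_le_iff₀ (hcoeff.reaction_pos s hs)]
      have h4 := mul_le_mul_of_nonneg_left h3 (show 0 ≤ 2 / ℓ₀ by positivity)
      have h5 : 2 / ℓ₀ * (ℓ₀ / 2) = 1 := by field_simp
      rw [h5] at h4
      linarith
    · refine ReactionDiffusion.integrableOn_Ioc_of_le_near_zero (C := (κ ^ q)⁻¹ * (2 * ℓ₀)) hWc hW0
        (lt_min hδ hs₁.1) fun s hs hsδ => ?_
      have hsδ' := lt_min_iff.1 hsδ
      refine (hupκ κ hκ s hs (hκz s ⟨hs.1, hsδ'.2⟩)).trans ?_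
      rw [mul_assoc]
      refine mul_le_mul_of_nonneg_left ?_ (inv_nonneg.2 (Real.rpow_nonneg hκ.le q))
      rw [mul_one_div, le_div_iff₀ (hcoeff.reaction_pos s hs), mul_comm]
      exact (hδs s ⟨hs.1, hsδ'.1⟩).2
  · subst hℓ
    obtain ⟨κ, δ, hκ, hδ, hκz⟩ := hlow hℓ₀ hpos hmin
    have hdiv : ∀ s ∈ Ioo (0 : ℝ) 1, (d s / s) ^ q = d s ^ q / s ^ q := fun s hs =>
      Real.div_rpow (hcoeff.d_pos s hs).le hs.1.le q
    constructor
    · refine ReactionDiffusion.integrableOn_Ioc_of_le_near_zero (C := K ^ q) (δ := 1) ?_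
        (fun s hs => Real.rpow_nonneg (div_nonneg (hcoeff.d_pos s hs).le hs.1.le) q) one_pos
        fun s hs _ => ?_
      · exact (hcoeff.continuousOn_d.div continuousOn_id fun s hs => hs.1.ne').rpow_const
          fun _ _ => Or.inr hq.le
      · rw [hdiv s hs]
        exact hlowK s hs
    · refine ReactionDiffusion.integrableOn_Ioc_of_le_near_zero (C := (κ ^ q)⁻¹) hWc hW0 hδ fun s hs hsδ => ?_
      rw [hdiv s hs]
      exact hupκ κ hκ s hs (hκz s hs hsδ)
  · obtain ⟨δ, μ, M, ξ, hδ, hδ1, hμ, hM, hξd, hξb⟩ := hξ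
    have hsub : Ioo 0 δ ⊆ Ioo (0 : ℝ) 1 := Ioo_subset_Ioo_right hδ1.le
    have hp1 : (p - 1) * q = 1 := mul_one_div_cancel (sub_pos.2 hcoeff.one_lt_p).ne'
    have hQpos : ∀ s ∈ Ioo 0 δ, 0 < d s * ρ s ^ (p - 1) := fun s hs =>
      mul_pos (hcoeff.d_pos s (hsub hs)) (Real.rpow_pos_of_pos (hcoeff.reaction_pos s (hsub hs)) _)
    -- Since `(p - 1) q = 1`, the function compared with `ξ` is the `1 / q` power of `k`.
    have hQ : ∀ s ∈ Ioo 0 δ, (d s * ρ s ^ (p - 1)) ^ q = ρ s * d s ^ q := fun s hs => by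
      have hρs := hcoeff.reaction_pos s (hsub hs)
      rw [Real.mul_rpow (hcoeff.d_pos s (hsub hs)).le (Real.rpow_nonneg hρs.le _),
        ← Real.rpow_mul hρs.le, hp1, Real.rpow_one, mul_comm]
    have hξpos : ∀ s ∈ Ioo 0 δ, 0 < ξ s := fun s hs =>
      pos_of_mul_pos_right ((hQpos s hs).trans_le (hξb s hs).2) hM.le
    obtain ⟨X, hX⟩ := isCompact_Icc.exists_bound_of_continuousOn
      (hξd.continuousOn_derivWithin (uniqueDiffOn_Icc hδ) le_rfl)
    have hX0 : 0 ≤ X := (norm_nonneg _).trans (hX 0 (left_mem_Icc.2 hδ.le))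
    -- The first bound makes `k / (κ ξ) ^ q ≥ H + 1`; the second makes the slope of `κ ξ` at least
    -- `-1`.
    set κ := min (μ / (H + 1) ^ (1 / q)) (1 / (X + 1)) with hκ_def
    have hκ : 0 < κ := lt_min (by positivity) (by positivity)
    have hκξ : ∀ s ∈ Ioo 0 δ, 0 < κ * ξ s := fun s hs => mul_pos hκ (hξpos s hs)
    obtain ⟨s₁, hs₁, hκz⟩ := hz.exists_barrier_le (H := H) (w := fun s => κ * ξ s)
      (w' := fun s => κ * derivWithin ξ (Icc 0 δ) s) hq hkpos hδ hδ1.le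
      (fun s hs => hHle s (hsub hs))
      (fun s hs => (((hξd.differentiableOn one_ne_zero) s
        (Ioo_subset_Icc_self hs)).hasDerivWithinAt.hasDerivAt
          (Icc_mem_nhds hs.1 hs.2)).const_mul κ)
      (fun s hs => by
        have h1 := (abs_le.1 (hX s (Ioo_subset_Icc_self hs))).1
        have h2 : κ * (X + 1) ≤ 1 := by
          rw [← le_div_iff₀ (by linarith)]
          exact min_le_right _ _
        have h3 := mul_le_mul_of_nonneg_left h1 hκ.le
        linarith)
      (fun s hs => by
        rw [← hQ s hs, ← Real.div_rpow (hQpos s hs).le (hκξ s hs).le]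
        have h1 : (H + 1) ^ (1 / q) ≤ d s * ρ s ^ (p - 1) / (κ * ξ s) := by
          rw [le_div_iff₀ (hκξ s hs)]
          refine le_trans ?_ (hξb s hs).1
          rw [← mul_assoc]
          refine mul_le_mul_of_nonneg_right ?_ (hξpos s hs).le
          rw [mul_comm, ← le_div_iff₀ (by positivity)]
          exact min_le_left _ _
        have h2 := Real.rpow_le_rpow (by positivity) h1 hq.le
        rwa [← Real.rpow_mul (by linarith), one_div_mul_cancel hq.ne', Real.rpow_one] at h2)
    refine ReactionDiffusion.integrableOn_Ioc_of_le_near_zero (C := (M / κ) ^ q) hWc hW0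
      (lt_min hδ hs₁.1) (fun s hs hsδ => ?_) hint
    have hsδ' := lt_min_iff.1 hsδ
    have hs' : s ∈ Ioo 0 δ := ⟨hs.1, hsδ'.1⟩
    have hρs := hcoeff.reaction_pos s hs
    -- The claim becomes `(d ρ ^ (p - 1) / z) ^ q ≤ (M / κ) ^ q`, which follows from `d ρ ^ (p - 1)
    -- ≤ M ξ` and `κ ξ ≤ z`.
    rw [mul_one_div, le_div_iff₀ hρs, div_mul_eq_mul_div, mul_comm (d s ^ q), ← hQ s hs',
      ← Real.div_rpow (hQpos s hs').le (hz.pos s hs).le]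
    refine Real.rpow_le_rpow (div_nonneg (hQpos s hs').le (hz.pos s hs).le) ?_ hq.le
    rw [div_le_iff₀ (hz.pos s hs)]
    calc d s * ρ s ^ (p - 1) ≤ M * ξ s := (hξb s hs').2
      _ = M / κ * (κ * ξ s) := by field_simp
      _ ≤ M / κ * z s :=
        mul_le_mul_of_nonneg_left (hκz s ⟨hs.1, hsδ'.2⟩) (div_pos hM hκ).le
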